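/- Let $d\ge 2$ and write $\hat h(\xi)=\int_{\mathbb R^d}h(x)e^{-2\pi i x\cdot\xi}\,dx$ (extended to $L^2(\mathbb R^d)$ by Plancherel). Let $\varphi\in\mathcal S(\mathbb R^d)$ be a radial Schwartz function with $\hat\varphi(\xi)=1$ for $|\xi|\le 1$ and $\hat\varphi(\xi)=0$ for $|\xi|\ge 2$, and put $\hat\psi(\xi)=\hat\varphi(\xi)-\hat\varphi(2\xi)$. Let $\sigma=\sigma_{2d-1}$ be the normalized surface measure on the unit sphere $S^{2d-1}\subset\mathbb R^{2d}=\mathbb R^d\times\mathbb R^d$, and $\hat\sigma(\xi,\eta)=\int_{S^{2d-1}}e^{-2\pi i(y\cdot\xi+z\cdot\eta)}\,d\sigma(y,z)$. For $i,j\ge 1$ and $f,g\in L^2(\mathbb R^d)$ define $$\mathcal A_1^{i,j}(f,g)(x)=\int_{\mathbb R^{2d}}\hat f(\xi)\,\hat g(\eta)\,\hat\sigma(\xi,\eta)\,\hat\psi(2^{-i}\xi)\,\hat\psi(2^{-j}\eta)\,e^{2\pi i x\cdot(\xi+\eta)}\,d\xi\,d\eta,\qquad x\in\mathbb R^d.$$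 Then there is a constant $C>0$, depending only on $d$ and $\varphi$, such that for all integers $i,j\ge1$ and all complex-valued $f,g\in L^2(\mathbb R^d)$ the integral above converges absolutely for every $x$, the function $\mathcal A_1^{i,j}(f,g)$ belongs to $L^1(\mathbb R^d)$, and $$\|\mathcal A_1^{i,j}(f,g)\|_{L^1(\mathbb R^d)}\le C\,2^{-(i+j)\frac{d-1}{2}}\,\|f\|_{L^2(\mathbb R^d)}\,\|g\|_{L^2(\mathbb R^d)}.$$ -/

import Mathlib

open MeasureTheory FourierTransform SchwartzMap
open scoped ENNReal RealInnerProductSpace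

noncomputable section

namespace BilinearSpherical

/-- The Euclidean space `ℝ^d`. -/
abbrev E (d : ℕ) : Type := EuclideanSpace ℝ (Fin d)

/-- The Euclidean space `ℝ^{2d} = ℝ^d × ℝ^d`, with the norm `|(y, z)|² = |y|² + |z|²`. -/
abbrev E2 (d : ℕ) : Type := WithLp 2 (E d × E d)

/-- The normalized surface measure `σ_{2d-1}` on the unit sphere `S^{2d-1}` of `ℝ^{2d}`. -/
def sphereMeasure (d : ℕ) : Measure (Metric.sphere (0 : E2 d) 1) :=
  ((volume : Measure (E2 d)).toSphere Set.univ)⁻¹ • (volume : Measure (E2 d)).toSphere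

/-- The Fourier transform of the normalized surface measure,
`σ̂(ξ, η) = ∫_{S^{2d-1}} e^{-2πi (y·ξ + z·η)} dσ(y, z)`. -/
def sphereMeasureHat (d : ℕ) (ξ η : E d) : ℂ :=
  ∫ w : Metric.sphere (0 : E2 d) 1,
    Complex.exp (-2 * Real.pi * Complex.I *
      ((⟪(w : E2 d).fst, ξ⟫ + ⟪(w : E2 d).snd, η⟫ : ℝ) : ℂ)) ∂(sphereMeasure d)

/-- `φ` is radial, `φ̂ = 1` on `{|ξ| ≤ 1}` and `φ̂ = 0` on `{|ξ| ≥ 2}`. -/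
structure IsLowFrequencyBump {d : ℕ} (φ : 𝓢(E d, ℂ)) : Prop where
  radial : ∀ x y : E d, ‖x‖ = ‖y‖ → φ x = φ y
  fourier_eq_one : ∀ ξ : E d, ‖ξ‖ ≤ 1 → (𝓕 φ) ξ = 1
  fourier_eq_zero : ∀ ξ : E d, 2 ≤ ‖ξ‖ → (𝓕 φ) ξ = 0

/-- `ψ̂(ξ) = φ̂(ξ) - φ̂(2ξ)`. -/
def psiHat {d : ℕ} (φ : 𝓢(E d, ℂ)) (ξ : E d) : ℂ :=
  (𝓕 φ) ξ - (𝓕 φ) ((2 : ℝ) • ξ)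

/-- The integrand
`f̂(ξ) ĝ(η) σ̂(ξ, η) ψ̂(2^{-i} ξ) ψ̂(2^{-j} η) e^{2πi x·(ξ + η)}` at `p = (ξ, η)`. Here `f̂`, `ĝ` are
the (Plancherel) Fourier transforms of `f, g ∈ L²(ℝ^d)`. -/
def pieceIntegrand {d : ℕ} (φ : 𝓢(E d, ℂ)) (i j : ℕ)
    (f g : Lp ℂ 2 (volume : Measure (E d))) (x : E d) (p : E d × E d) : ℂ :=
  (𝓕 f : Lp ℂ 2 (volume : Measure (E d))) p.1 *
    (𝓕 g : Lp ℂ 2 (volume : Measure (E d))) p.2 *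
    sphereMeasureHat d p.1 p.2 *
    psiHat φ ((2 : ℝ) ^ (-(i : ℤ)) • p.1) * psiHat φ ((2 : ℝ) ^ (-(j : ℤ)) • p.2) *
    Complex.exp (2 * Real.pi * Complex.I * ((⟪x, p.1 + p.2⟫ : ℝ) : ℂ))

/-- The piece `𝒜₁^{i,j}(f, g)(x)`, for `i, j ≥ 1`, of the bilinear spherical average. -/
def sphericalPiece {d : ℕ} (φ : 𝓢(E d, ℂ)) (i j : ℕ)
    (f g : Lp ℂ 2 (volume : Measure (E d))) (x : E d) : ℂ :=
  ∫ p : E d × E d, pieceIntegrand φ i j f g x p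

end BilinearSpherical

end

open MeasureTheory FourierTransform SchwartzMap
open scoped ENNReal RealInnerProductSpace

noncomputable section

namespace BilinearSpherical


/-! The symbol `σ̂(ξ, η)` is an average of tensor products. The sphere integral equals, up to a
constant, the integral over the unit ball of the function extended with homogeneity zero. In polar
coordinates in each factor `ℝ^d`, the two angular integrals separate. With `d = n + 2` and `J(l) =
∫₀^π sin^n θ e^{-il cos θ} dθ`, this makes `σ̂(ξ, η)` a constant times the integral of `J(2π|ξ|r/N)
J(2π|η|s/N) (rs)^{d-1}` over the quarter disk, where `N = √(r² + s²)`
(`exists_sphereMeasureHat_eq`).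

For fixed `(r, s)` the operator is the product of a linear multiplier applied to `f` and one applied
to `g`, so Cauchy–Schwarz and Plancherel bound its `L¹` norm by a product of `L²` norms
(`eLpNorm_integral_tensorIntegrand_le`). The Bessel decay `|J(l)| ≤ C l^{-(d-1)/2}`
(`exists_norm_cosOscillatory_le_rpow`) and the localization `|ξ| ≥ 2^{i-1}`, `|η| ≥ 2^{j-1}` give
`2^{-(i+j)(d-1)/2}`, at the cost of the singular factor `(rs/N²)^{-(d-1)/2}`. The density
`(rs)^{d-1}` absorbs it (`lintegral_quarterDiskMeasure_rpow_le`). -/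

/-! ### Decay of the Bessel type integral `J`. -/

/-- Decay at infinity of the solutions of the Bessel type equation `f'' + (m / x) f' + f = 0`. -/
theorem exists_pow_mul_sq_le_of_besselODE (m : ℕ) (f f' : ℝ → ℝ)
    (hf : ∀ x, 0 < x → HasDerivAt f (f' x) x)
    (hf' : ∀ x, 0 < x → HasDerivAt f' (-f x - m / x * f' x) x) :
    ∃ C : ℝ, ∀ x, 1 ≤ x → x ^ m * f x ^ 2 ≤ C := by
  set α : ℝ := m / 2 with hα
  set K : ℝ := |α ^ 2 - α| with hK
  -- With `u = x^α f` one has `u' = x^α v` and `u'' + u = (α² - α) u / x²`. The energy `u² + u'² =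
  -- x^m (f² + v²)` thus has derivative at most `K / x²` times itself, and the factor `exp(K / x)`
  -- in `G` makes it nonincreasing.
  set v : ℝ → ℝ := fun x => f' x + α * (x⁻¹ * f x) with hv
  set G : ℝ → ℝ := fun x => x ^ m * (f x ^ 2 + v x ^ 2) * Real.exp (K * x⁻¹) with hG
  have hvd : ∀ x, 0 < x → HasDerivAt v
      (-f x - α / x * v x + (α ^ 2 - α) / x ^ 2 * f x) x := by
    intro x hx
    have h := (hf' x hx).add (((hasDerivAt_inv hx.ne').mul (hf x hx)).const_mul α)
    refine h.congr_deriv ?_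
    have hm : (m : ℝ) = 2 * α := by rw [hα]; ring
    rw [hm, show v x = f' x + α * (x⁻¹ * f x) from rfl]
    field_simp
    ring
  have hGd : ∀ x, 0 < x → HasDerivAt G
      (x ^ m / x ^ 2 * Real.exp (K * x⁻¹) *
        (2 * (α ^ 2 - α) * (f x * v x) - K * (f x ^ 2 + v x ^ 2))) x := by
    intro x hx
    have h := (((hasDerivAt_pow m x).mul (((hf x hx).pow 2).add ((hvd x hx).pow 2))).mul
      (((hasDerivAt_inv hx.ne').const_mul K).exp))
    refine h.congr_deriv ?_
    have hm : (m : ℝ) = 2 * α := by rw [hα]; ring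
    have hp : (m : ℝ) * x ^ (m - 1) = 2 * α * (x ^ m / x) := by
      rw [hm]
      rcases Nat.eq_zero_or_pos m with h0 | h0
      · simp [hα, h0]
      · rw [show x ^ m = x ^ (m - 1) * x by rw [← pow_succ, Nat.sub_add_cancel h0]]
        field_simp
    have hf'v : f' x = v x - α / x * f x := by simp only [hv]; field_simp; ring
    simp only [Pi.mul_apply, Pi.add_apply, Pi.pow_apply]
    rw [hp, hf'v]
    simp only [Nat.cast_ofNat]
    field_simp
    ring
  have hanti : AntitoneOn G (Set.Ici 1) := by
    refine antitoneOn_of_deriv_nonpos (convex_Ici 1)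
      (fun x hx => (hGd x (lt_of_lt_of_le one_pos hx)).continuousAt.continuousWithinAt)
      (fun x hx => ?_) (fun x hx => ?_)
    · rw [interior_Ici] at hx
      exact (hGd x (one_pos.trans hx)).differentiableAt.differentiableWithinAt
    · rw [interior_Ici] at hx
      have hx0 : 0 < x := one_pos.trans hx
      rw [(hGd x hx0).deriv]
      refine mul_nonpos_of_nonneg_of_nonpos (by positivity) ?_
      have h1 : (α ^ 2 - α) * (2 * (f x * v x)) ≤ K * |2 * (f x * v x)| := by
        rw [hK, ← abs_mul]; exact le_abs_self _
      have h2 : |2 * (f x * v x)| ≤ f x ^ 2 + v x ^ 2 := by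
        rw [abs_le]; constructor <;> nlinarith [sq_nonneg (f x - v x), sq_nonneg (f x + v x)]
      have h3 := mul_le_mul_of_nonneg_left h2 (abs_nonneg (α ^ 2 - α))
      linarith
  refine ⟨G 1, fun x hx => ?_⟩
  have hx0 : 0 < x := lt_of_lt_of_le one_pos hx
  refine le_trans ?_ (hanti (Set.mem_Ici.2 le_rfl) hx hx)
  have h1 : 1 ≤ Real.exp (K * x⁻¹) := Real.one_le_exp (by positivity)
  have h2 : x ^ m * f x ^ 2 ≤ x ^ m * (f x ^ 2 + v x ^ 2) := by
    gcongr; nlinarith [sq_nonneg (v x)]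
  calc x ^ m * f x ^ 2 ≤ x ^ m * (f x ^ 2 + v x ^ 2) := h2
    _ ≤ x ^ m * (f x ^ 2 + v x ^ 2) * Real.exp (K * x⁻¹) :=
        le_mul_of_one_le_right (by positivity) h1

/-- The oscillatory integral `∫₀^π W(θ) e^{-iλ cos θ} dθ`. -/
noncomputable def cosOscillatory (W : ℝ → ℂ) (l : ℝ) : ℂ :=
  ∫ θ in (0 : ℝ)..Real.pi, W θ * Complex.exp (-(l * Real.cos θ : ℝ) * Complex.I)

theorem hasDerivAt_cosOscillatory {W : ℝ → ℂ} (hW : Continuous W) (l : ℝ) :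
    HasDerivAt (cosOscillatory W)
      (cosOscillatory (fun θ => W θ * (-(Real.cos θ : ℂ) * Complex.I)) l) l := by
  refine (intervalIntegral.hasDerivAt_integral_of_dominated_loc_of_deriv_le (𝕜 := ℝ)
    (μ := volume) (a := 0) (b := Real.pi) (s := Set.univ) (bound := fun θ => ‖W θ‖)
    (F := fun l θ => W θ * Complex.exp (-(l * Real.cos θ : ℝ) * Complex.I))
    (F' := fun l θ => W θ * (-(Real.cos θ : ℂ) * Complex.I) *
      Complex.exp (-(l * Real.cos θ : ℝ) * Complex.I))
    Filter.univ_mem ?_ ?_ ?_ ?_ ?_ ?_).2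
  · refine Filter.Eventually.of_forall fun x => Continuous.aestronglyMeasurable (by fun_prop)
  · exact Continuous.intervalIntegrable (by fun_prop) _ _
  · exact Continuous.aestronglyMeasurable (by fun_prop)
  · refine Filter.Eventually.of_forall fun θ _ x _ => ?_
    have h : ‖Complex.exp (-(x * Real.cos θ : ℝ) * Complex.I)‖ = 1 := by
      rw [← Complex.ofReal_neg, Complex.norm_exp_ofReal_mul_I]
    rw [norm_mul, h, norm_mul, norm_mul, norm_neg, Complex.norm_I, Complex.norm_real, mul_one,
      mul_one]
    exact mul_le_of_le_one_right (norm_nonneg _) (Real.abs_cos_le_one θ)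
  · exact Continuous.intervalIntegrable (by fun_prop) _ _
  · refine Filter.Eventually.of_forall fun θ _ x _ => ?_
    have h1 : HasDerivAt (fun x : ℝ => (-(x * Real.cos θ : ℝ) : ℂ) * Complex.I)
        (-(Real.cos θ : ℂ) * Complex.I) x := by
      have := (((hasDerivAt_id x).mul_const (Real.cos θ)).ofReal_comp.neg).mul_const Complex.I
      simpa using this
    refine ((h1.cexp).const_mul (W θ)).congr_deriv ?_
    ring

/-- This is the Bessel equation `l J'' = -l J - (n + 1) J'`, since each derivative in `l` multiplies
the weight by `-i cos θ`. It comes from integrating the `θ`-derivative of `sin^{n+1} θ e^{-il cos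
θ}`, which vanishes at both endpoints. -/
theorem cosOscillatory_besselODE (n : ℕ) (l : ℝ) :
    l * cosOscillatory (fun θ => (Real.sin θ : ℂ) ^ n * (-(Real.cos θ : ℂ) * Complex.I) *
        (-(Real.cos θ : ℂ) * Complex.I)) l =
      - l * cosOscillatory (fun θ => (Real.sin θ : ℂ) ^ n) l - (n + 1 : ℝ) *
        cosOscillatory (fun θ => (Real.sin θ : ℂ) ^ n * (-(Real.cos θ : ℂ) * Complex.I)) l := by
  have key : ∫ θ in (0 : ℝ)..Real.pi,
      (((n + 1 : ℝ) * ((Real.sin θ : ℂ) ^ n * Real.cos θ) +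
        Complex.I * l * (Real.sin θ : ℂ) ^ (n + 2)) *
        Complex.exp (-(l * Real.cos θ : ℝ) * Complex.I)) = 0 := by
    rw [intervalIntegral.integral_eq_sub_of_hasDerivAt
      (f := fun θ : ℝ => (Real.sin θ : ℂ) ^ (n + 1) *
        Complex.exp (-(l * Real.cos θ : ℝ) * Complex.I))]
    · simp
    · intro θ _
      have h1 : HasDerivAt (fun θ : ℝ => (Real.sin θ : ℂ)) (Real.cos θ : ℂ) θ :=
        (Real.hasDerivAt_sin θ).ofReal_comp
      have h2 : HasDerivAt (fun θ : ℝ => (-(l * Real.cos θ : ℝ) : ℂ) * Complex.I)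
          ((l * Real.sin θ : ℝ) * Complex.I) θ := by
        have := (((Real.hasDerivAt_cos θ).const_mul l).ofReal_comp.neg).mul_const Complex.I
        simpa using this
      have := (h1.pow (n + 1)).mul h2.cexp
      refine this.congr_deriv ?_
      simp only [Nat.add_sub_cancel, Pi.pow_apply]
      push_cast
      ring
    · exact Continuous.intervalIntegrable (by fun_prop) _ _
  have h := congrArg (fun z => -Complex.I * z) key
  simp only [mul_zero] at h
  rw [← sub_eq_zero, ← h]
  unfold cosOscillatory
  simp only [← intervalIntegral.integral_const_mul]
  rw [← intervalIntegral.integral_sub, ← intervalIntegral.integral_sub]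
  · refine intervalIntegral.integral_congr fun θ _ => ?_
    have hs : (Real.cos θ : ℂ) ^ 2 = 1 - (Real.sin θ : ℂ) ^ 2 := by
      rw [← Complex.ofReal_pow, ← Complex.ofReal_pow, Real.cos_sq']; push_cast; ring
    have hI : Complex.I ^ 2 = -1 := Complex.I_sq
    push_cast
    push_cast at hs
    linear_combination ((l : ℂ) * Complex.sin θ ^ n * Complex.exp (-(l * Complex.cos θ) * Complex.I) *
      (Complex.cos θ ^ 2 + Complex.sin θ ^ 2)) * hI -
      ((l : ℂ) * Complex.sin θ ^ n * Complex.exp (-(l * Complex.cos θ) * Complex.I)) * hs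
  all_goals exact Continuous.intervalIntegrable (by fun_prop) _ _

theorem norm_cosOscillatory_sin_pow_le (n : ℕ) (l : ℝ) :
    ‖cosOscillatory (fun θ => (Real.sin θ : ℂ) ^ n) l‖ ≤ Real.pi := by
  have := intervalIntegral.norm_integral_le_of_norm_le_const (a := 0) (b := Real.pi) (C := 1)
    (f := fun θ : ℝ => (Real.sin θ : ℂ) ^ n * Complex.exp (-(l * Real.cos θ : ℝ) * Complex.I))
    (fun θ _ => by
      rw [norm_mul, ← Complex.ofReal_neg, Complex.norm_exp_ofReal_mul_I, mul_one, norm_pow,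
        Complex.norm_real]
      exact pow_le_one₀ (norm_nonneg _) (Real.abs_sin_le_one θ))
  rw [sub_zero, one_mul, abs_of_pos Real.pi_pos] at this
  exact this

theorem exists_pow_mul_norm_sq_cosOscillatory_le (n : ℕ) :
    ∃ C : ℝ, ∀ l, 0 < l →
      l ^ (n + 1) * ‖cosOscillatory (fun θ => (Real.sin θ : ℂ) ^ n) l‖ ^ 2 ≤ C := by
  set W : ℝ → ℂ := fun θ => (Real.sin θ : ℂ) ^ n with hW
  set W1 : ℝ → ℂ := fun θ => W θ * (-(Real.cos θ : ℂ) * Complex.I) with hW1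
  have hWc : Continuous W := by fun_prop
  have hW1c : Continuous W1 := by fun_prop
  have hd (l : ℝ) := hasDerivAt_cosOscillatory hWc l
  have hd1 : ∀ l, 0 < l → HasDerivAt (cosOscillatory W1)
      (-cosOscillatory W l - ((n + 1 : ℕ) / l : ℝ) * cosOscillatory W1 l) l := by
    intro l hl
    refine (hasDerivAt_cosOscillatory hW1c l).congr_deriv ?_
    have h := cosOscillatory_besselODE n l
    have hl' : (l : ℂ) ≠ 0 := by exact_mod_cast hl.ne'
    apply mul_left_cancel₀ hl'
    rw [show (fun θ => W1 θ * (-(Real.cos θ : ℂ) * Complex.I)) =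
      fun θ => (Real.sin θ : ℂ) ^ n * (-(Real.cos θ : ℂ) * Complex.I) *
        (-(Real.cos θ : ℂ) * Complex.I) from rfl, h]
    rw [mul_sub, ← hW, ← hW1, Complex.ofReal_div, ← mul_assoc, mul_div_cancel₀ _ hl']
    push_cast
    ring
  -- The energy estimate is for real functions; the equation has real coefficients, so it applies to
  -- real and imaginary parts separately.
  obtain ⟨C1, h1⟩ := exists_pow_mul_sq_le_of_besselODE (n + 1)
    (fun l => (cosOscillatory W l).re) (fun l => (cosOscillatory W1 l).re)
    (fun x _ => Complex.reCLM.hasFDerivAt.comp_hasDerivAt x (hd x))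
    (fun x hx => by
      have := Complex.reCLM.hasFDerivAt.comp_hasDerivAt x (hd1 x hx)
      simp only [Complex.reCLM_apply, Complex.sub_re, Complex.neg_re, Complex.re_ofReal_mul] at this
      exact this)
  obtain ⟨C2, h2⟩ := exists_pow_mul_sq_le_of_besselODE (n + 1)
    (fun l => (cosOscillatory W l).im) (fun l => (cosOscillatory W1 l).im)
    (fun x _ => Complex.imCLM.hasFDerivAt.comp_hasDerivAt x (hd x))
    (fun x hx => by
      have := Complex.imCLM.hasFDerivAt.comp_hasDerivAt x (hd1 x hx)
      simp only [Complex.imCLM_apply, Complex.sub_im, Complex.neg_im, Complex.im_ofReal_mul] at this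
      exact this)
  refine ⟨max (C1 + C2) (Real.pi ^ 2), fun l hl => ?_⟩
  rcases le_total 1 l with h | h
  · refine le_max_of_le_left ?_
    have := add_le_add (h1 l h) (h2 l h)
    rw [← Complex.normSq_eq_norm_sq, Complex.normSq_apply]
    calc _ = _ := by ring
      _ ≤ _ := this
  -- For `l ≤ 1` the trivial bound `|J| ≤ π` suffices.
  · refine le_max_of_le_right ?_
    calc _ ≤ 1 * Real.pi ^ 2 := by
          gcongr
          · exact pow_le_one₀ hl.le h
          · exact norm_cosOscillatory_sin_pow_le n l
      _ = _ := one_mul _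


/-! ### Polar coordinates adapted to a direction. -/

/-- The measure `r ^ k dr` on `(0, ∞)`. -/
def radialMeasure (k : ℕ) : Measure ℝ :=
  (volume.restrict (Set.Ioi 0)).withDensity fun r => ENNReal.ofReal (r ^ k)

/-- The measure `sin θ ^ n dθ` on `(0, π)`. -/
def polarAngleMeasure (n : ℕ) : Measure ℝ :=
  (volume.restrict (Set.Ioo 0 Real.pi)).withDensity fun θ => ENNReal.ofReal (Real.sin θ ^ n)

instance (k : ℕ) : SFinite (radialMeasure k) := by unfold radialMeasure; infer_instance

instance (n : ℕ) : IsFiniteMeasure (polarAngleMeasure n) := by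
  unfold polarAngleMeasure
  refine isFiniteMeasure_withDensity_ofReal (Integrable.hasFiniteIntegral ?_)
  rw [← IntegrableOn, ← integrableOn_Icc_iff_integrableOn_Ioo]
  exact (by fun_prop : Continuous fun θ => Real.sin θ ^ n).continuousOn.integrableOn_Icc

theorem lintegral_radialMeasure (k : ℕ) {f : ℝ → ℝ≥0∞} (hf : Measurable f) :
    ∫⁻ r, f r ∂radialMeasure k = ∫⁻ r in Set.Ioi 0, ENNReal.ofReal (r ^ k) * f r := by
  rw [radialMeasure, lintegral_withDensity_eq_lintegral_mul _ (by fun_prop) hf]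
  rfl

theorem lintegral_fun_norm_addHaar {V : Type*} [NormedAddCommGroup V] [NormedSpace ℝ V]
    [MeasurableSpace V] [BorelSpace V] [FiniteDimensional ℝ V]
    (μ : Measure V) [μ.IsAddHaarMeasure] [Nontrivial V] {f : ℝ → ℝ≥0∞} (hf : Measurable f) :
    ∫⁻ x, f ‖x‖ ∂μ = μ.toSphere Set.univ *
      ∫⁻ r, f r ∂radialMeasure (Module.finrank ℝ V - 1) := by
  calc
    ∫⁻ x, f ‖x‖ ∂μ = ∫⁻ x : ({(0)}ᶜ : Set V), f (‖x.1‖) ∂(μ.comap (↑)) := by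
      rw [lintegral_subtype_comap (measurableSet_singleton _).compl fun x ↦ f (‖x‖),
        restrict_compl_singleton]
    _ = ∫⁻ x, f x.2 ∂μ.toSphere.prod (.volumeIoiPow (Module.finrank ℝ V - 1)) := by
      simpa using μ.measurePreserving_homeomorphUnitSphereProd.lintegral_comp_emb
        (Homeomorph.measurableEmbedding _) (f ∘ Subtype.val ∘ Prod.snd)
    _ = μ.toSphere Set.univ *
        ∫⁻ x : Set.Ioi (0 : ℝ), f x ∂.volumeIoiPow (Module.finrank ℝ V - 1) := by
      rw [lintegral_prod _ (by fun_prop)]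
      simp [mul_comm]
    _ = _ := by
      rw [lintegral_radialMeasure _ hf, Measure.volumeIoiPow,
        lintegral_withDensity_eq_lintegral_mul _ (by fun_prop) (by fun_prop)]
      congr 1
      exact lintegral_subtype_comap measurableSet_Ioi
        fun a : ℝ ↦ ENNReal.ofReal (a ^ (Module.finrank ℝ V - 1)) * f a

/-- Integrals of degree zero homogeneous functions over a ball are integrals over the sphere. -/
theorem setIntegral_ball_inv_norm_smul {V : Type*} [NormedAddCommGroup V] [NormedSpace ℝ V]
    [MeasurableSpace V] [BorelSpace V] [FiniteDimensional ℝ V]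
    (μ : Measure V) [μ.IsAddHaarMeasure] [Nontrivial V] (h : V → ℂ) :
    (Module.finrank ℝ V : ℂ) * ∫ x in Metric.ball 0 1, h (‖x‖⁻¹ • x) ∂μ =
      ∫ w : Metric.sphere (0 : V) 1, h w ∂μ.toSphere := by
  have h1 : ∫ x in Metric.ball 0 1, h (‖x‖⁻¹ • x) ∂μ =
      ∫ p : Metric.sphere (0 : V) 1 × Set.Ioi (0 : ℝ), h p.1 *
        (Set.Iio (1 : ℝ)).indicator 1 (p.2 : ℝ)
        ∂μ.toSphere.prod (.volumeIoiPow (Module.finrank ℝ V - 1)) := by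
    calc ∫ x in Metric.ball 0 1, h (‖x‖⁻¹ • x) ∂μ
        = ∫ x, h (‖x‖⁻¹ • x) * (Set.Iio (1 : ℝ)).indicator 1 ‖x‖ ∂μ := by
          rw [← integral_indicator measurableSet_ball]
          congr 1
          ext x
          by_cases hx : ‖x‖ < 1 <;> simp [hx]
      _ = ∫ x : ({(0)}ᶜ : Set V), h (‖x.1‖⁻¹ • x.1) *
            (Set.Iio (1 : ℝ)).indicator 1 ‖x.1‖ ∂(μ.comap (↑)) := by
          rw [integral_subtype_comap (measurableSet_singleton _).compl
            fun x ↦ h (‖x‖⁻¹ • x) * (Set.Iio (1 : ℝ)).indicator 1 ‖x‖, restrict_compl_singleton]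
      _ = _ := by
          simpa using μ.measurePreserving_homeomorphUnitSphereProd.integral_comp
            (Homeomorph.measurableEmbedding _)
            (fun p : Metric.sphere (0 : V) 1 × Set.Ioi (0 : ℝ) => h p.1 *
              (Set.Iio (1 : ℝ)).indicator 1 (p.2 : ℝ))
  -- The radial factor is `∫₀¹ r^{D-1} dr = 1 / D`, with `D` the dimension of `V`.
  have h2 : ∫ r : Set.Ioi (0 : ℝ), (Set.Iio (1 : ℝ)).indicator (1 : ℝ → ℂ) (r : ℝ)
      ∂(Measure.volumeIoiPow (Module.finrank ℝ V - 1)) = (Module.finrank ℝ V : ℂ)⁻¹ := by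
    have h3 : (fun r : Set.Ioi (0 : ℝ) => (Set.Iio (1 : ℝ)).indicator (1 : ℝ → ℂ) (r : ℝ)) =
        (Set.Iio (⟨1, Set.mem_Ioi.2 one_pos⟩ : Set.Ioi (0 : ℝ))).indicator 1 := by
      ext r
      by_cases hr : (r : ℝ) < 1
      · rw [Set.indicator_of_mem (by exact hr), Set.indicator_of_mem (by exact hr)]; rfl
      · rw [Set.indicator_of_notMem (by exact hr), Set.indicator_of_notMem (by exact hr)]
    have hpos : 0 < Module.finrank ℝ V := Module.finrank_pos
    rw [h3, integral_indicator measurableSet_Iio]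
    simp only [Pi.one_apply, integral_const, measureReal_def, Measure.restrict_apply_univ,
      Measure.volumeIoiPow_apply_Iio]
    rw [ENNReal.toReal_ofReal (by positivity), Nat.cast_pred hpos]
    simp
  have hne : (Module.finrank ℝ V : ℂ) ≠ 0 := by
    exact_mod_cast (Module.finrank_pos (R := ℝ) (M := V)).ne'
  rw [h1, integral_prod_mul (fun w : Metric.sphere (0 : V) 1 => h w)
    (fun r : Set.Ioi (0 : ℝ) => (Set.Iio (1 : ℝ)).indicator (1 : ℝ → ℂ) (r : ℝ)), h2]
  field_simp

/-- Substituting `t = r cos θ`, `s = r sin θ` turns `s^n dt ds` on `{s > 0}` into `r^{n+1} sin^n θ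
dr dθ`. -/
theorem lintegral_polar_upperHalfPlane (n : ℕ) {F : ℝ × ℝ → ℝ≥0∞} (hF : Measurable F) :
    ∫⁻ t : ℝ, ∫⁻ s, F (√(t ^ 2 + s ^ 2), t) ∂radialMeasure n =
      ∫⁻ p, F (p.1, p.1 * Real.cos p.2) ∂(radialMeasure (n + 1)).prod (polarAngleMeasure n) := by
  have hL : ∫⁻ t : ℝ, ∫⁻ s, F (√(t ^ 2 + s ^ 2), t) ∂radialMeasure n =
      ∫⁻ p : ℝ × ℝ, (Set.Ioi (0 : ℝ)).indicator
        (fun s => ENNReal.ofReal (s ^ n) * F (√(p.1 ^ 2 + s ^ 2), p.1)) p.2 := by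
    rw [Measure.volume_eq_prod, lintegral_prod]
    · refine lintegral_congr fun t => ?_
      rw [lintegral_radialMeasure _ (by fun_prop), ← lintegral_indicator measurableSet_Ioi]
    · have : (fun p : ℝ × ℝ => (Set.Ioi (0 : ℝ)).indicator
          (fun s => ENNReal.ofReal (s ^ n) * F (√(p.1 ^ 2 + s ^ 2), p.1)) p.2) =
          (Prod.snd ⁻¹' Set.Ioi (0 : ℝ)).indicator
            (fun p : ℝ × ℝ => ENNReal.ofReal (p.2 ^ n) * F (√(p.1 ^ 2 + p.2 ^ 2), p.1)) := by
        ext p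
        simp [Set.indicator]
      rw [this]
      exact (Measurable.indicator (by fun_prop) (measurable_snd measurableSet_Ioi)).aemeasurable
  have hR : ∫⁻ p, F (p.1, p.1 * Real.cos p.2)
        ∂(radialMeasure (n + 1)).prod (polarAngleMeasure n) =
      ∫⁻ p in Set.Ioi (0 : ℝ) ×ˢ Set.Ioo 0 Real.pi,
        ENNReal.ofReal (p.1 ^ (n + 1)) * ENNReal.ofReal (Real.sin p.2 ^ n) *
          F (p.1, p.1 * Real.cos p.2) := by
    rw [radialMeasure, polarAngleMeasure, prod_withDensity (by fun_prop) (by fun_prop),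
      Measure.prod_restrict, ← Measure.volume_eq_prod,
      lintegral_withDensity_eq_lintegral_mul _ (by fun_prop) (by fun_prop)]
    rfl
  rw [hL, hR, ← lintegral_comp_polarCoord_symm,
    ← lintegral_indicator polarCoord.open_target.measurableSet,
    ← lintegral_indicator (measurableSet_Ioi.prod measurableSet_Ioo)]
  refine lintegral_congr fun p => ?_
  by_cases hp : p ∈ polarCoord.target
  · rw [Set.indicator_of_mem hp]
    have hp' : 0 < p.1 ∧ -Real.pi < p.2 ∧ p.2 < Real.pi := hp
    have hsq : √((p.1 * Real.cos p.2) ^ 2 + (p.1 * Real.sin p.2) ^ 2) = p.1 := by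
      rw [mul_pow, mul_pow, ← mul_add, Real.cos_sq_add_sin_sq, mul_one, Real.sqrt_sq hp'.1.le]
    rw [polarCoord_symm_apply]
    by_cases h0 : 0 < p.2
    · have hs : 0 < Real.sin p.2 := Real.sin_pos_of_pos_of_lt_pi h0 hp'.2.2
      rw [Set.indicator_of_mem (show p ∈ Set.Ioi (0 : ℝ) ×ˢ Set.Ioo 0 Real.pi from
        ⟨hp'.1, h0, hp'.2.2⟩), Set.indicator_of_mem (show _ ∈ Set.Ioi (0 : ℝ) from
          mul_pos hp'.1 hs), hsq, smul_eq_mul, ← mul_assoc, ← ENNReal.ofReal_mul hp'.1.le,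
        ← ENNReal.ofReal_mul (by have := hp'.1; positivity)]
      congr 2
      ring
    -- `polarCoord` lets the angle range over `(-π, π)`; nonpositive angles land outside `{s > 0}`
    -- and contribute nothing.
    · have hs : Real.sin p.2 ≤ 0 := Real.sin_nonpos_of_nonpos_of_neg_pi_le (not_lt.1 h0) hp'.2.1.le
      rw [Set.indicator_of_notMem (show p.1 * Real.sin p.2 ∉ Set.Ioi (0 : ℝ) from
          not_lt.2 (mul_nonpos_of_nonneg_of_nonpos hp'.1.le hs)), smul_zero,
        Set.indicator_of_notMem (fun h => h0 h.2.1)]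
  · rw [Set.indicator_of_notMem hp, Set.indicator_of_notMem]
    exact fun h => hp ⟨h.1, by linarith [Real.pi_pos, h.2.1], h.2.2⟩

/-- The area of the unit sphere of dimension `n` in `ℝ^(n+1)`. -/
def sphereArea (n : ℕ) : ℝ≥0∞ :=
  (volume : Measure (EuclideanSpace ℝ (Fin (n + 1)))).toSphere Set.univ

theorem toSphere_univ_eq_sphereArea {V : Type*} [NormedAddCommGroup V] [InnerProductSpace ℝ V]
    [MeasurableSpace V] [BorelSpace V] [FiniteDimensional ℝ V] {n : ℕ}
    (hV : Module.finrank ℝ V = n + 1) :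
    (volume : Measure V).toSphere Set.univ = sphereArea n := by
  have : Nontrivial V := Module.nontrivial_of_finrank_pos (R := ℝ) (by omega)
  rw [sphereArea, Measure.toSphere_apply_univ, Measure.toSphere_apply_univ,
    InnerProductSpace.volume_ball, InnerProductSpace.volume_ball, hV, finrank_euclideanSpace_fin]

theorem measurePreserving_smul_add_orthogonal {V : Type*} [NormedAddCommGroup V]
    [InnerProductSpace ℝ V] [MeasurableSpace V] [BorelSpace V] [FiniteDimensional ℝ V]
    {e : V} (he : ‖e‖ = 1) :
    MeasurePreserving (fun p : ℝ × (ℝ ∙ e)ᗮ => p.1 • e + (p.2 : V)) := by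
  have h1 : MeasurePreserving (Prod.map (LinearIsometryEquiv.toSpanUnitSingleton (𝕜 := ℝ) e he)
      (id : (ℝ ∙ e)ᗮ → (ℝ ∙ e)ᗮ)) :=
    (LinearIsometryEquiv.measurePreserving _).prod (MeasurePreserving.id _)
  have h2 := (((ℝ ∙ e).orthogonalDecomposition.symm.measurePreserving).comp
    (WithLp.volume_preserving_toLp (ℝ ∙ e) (ℝ ∙ e)ᗮ)).comp h1
  convert h2 using 1
  ext p
  simp

/-- Write `y = t e + w` with `w ⊥ e`: then `|y| = √(t² + |w|²)` and `y·e = t`. Radial integration in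
`w`, which ranges over dimension `n + 1`, leaves a half-plane integral with weight `s^n`. -/
theorem lintegral_norm_inner {V : Type*} [NormedAddCommGroup V]
    [InnerProductSpace ℝ V] [MeasurableSpace V] [BorelSpace V] [FiniteDimensional ℝ V] {n : ℕ}
    (hV : Module.finrank ℝ V = n + 2) {e : V} (he : ‖e‖ = 1)
    {F : ℝ × ℝ → ℝ≥0∞} (hF : Measurable F) :
    ∫⁻ y : V, F (‖y‖, ⟪y, e⟫) = sphereArea n *
      ∫⁻ p, F (p.1, p.1 * Real.cos p.2) ∂(radialMeasure (n + 1)).prod (polarAngleMeasure n) := by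
  have he0 : e ≠ 0 := by rintro rfl; simp at he
  have hfin : Module.finrank ℝ (ℝ ∙ e)ᗮ = n + 1 := by
    have := Submodule.finrank_add_finrank_orthogonal (ℝ ∙ e)
    rw [finrank_span_singleton he0] at this
    omega
  have : Nontrivial (ℝ ∙ e)ᗮ := Module.nontrivial_of_finrank_pos (R := ℝ) (by omega)
  have hkey : ∀ p : ℝ × (ℝ ∙ e)ᗮ, F (‖p.1 • e + (p.2 : V)‖, ⟪p.1 • e + (p.2 : V), e⟫) =
      F (√(p.1 ^ 2 + ‖p.2‖ ^ 2), p.1) := by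
    intro p
    have ho : ⟪(p.2 : V), e⟫ = 0 := by
      rw [real_inner_comm]; exact Submodule.mem_orthogonal_singleton_iff_inner_right.1 p.2.2
    congr 2
    · rw [eq_comm, Real.sqrt_eq_iff_mul_self_eq (by positivity) (by positivity),
        norm_add_mul_self_real, real_inner_smul_left, real_inner_comm, ho, norm_smul, he]
      simp; ring
    · rw [inner_add_left, ho, real_inner_smul_left, real_inner_self_eq_norm_sq, he]; simp
  rw [← (measurePreserving_smul_add_orthogonal he).lintegral_comp (by fun_prop)]
  simp_rw [hkey]
  rw [← lintegral_polar_upperHalfPlane n hF, Measure.volume_eq_prod, lintegral_prod _ (by fun_prop),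
    ← lintegral_const_mul]
  · refine lintegral_congr fun t => ?_
    have := lintegral_fun_norm_addHaar (volume : Measure (ℝ ∙ e)ᗮ)
      (f := fun s => F (√(t ^ 2 + s ^ 2), t)) (by fun_prop)
    rw [this, toSphere_univ_eq_sphereArea hfin, hfin, Nat.add_sub_cancel]
  · exact Measurable.lintegral_prod_right' (f := fun p : ℝ × ℝ => F (√(p.1 ^ 2 + p.2 ^ 2), p.1))
      (by fun_prop)


/-- The pushforward form allows complex integrands and products of two such spaces. -/
theorem map_norm_inner_volume {V : Type*} [NormedAddCommGroup V]
    [InnerProductSpace ℝ V] [MeasurableSpace V] [BorelSpace V] [FiniteDimensional ℝ V] {n : ℕ}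
    (hV : Module.finrank ℝ V = n + 2) {e : V} (he : ‖e‖ = 1) :
    Measure.map (fun y : V => (‖y‖, ⟪y, e⟫)) volume = sphereArea n •
      Measure.map (fun p : ℝ × ℝ => (p.1, p.1 * Real.cos p.2))
        ((radialMeasure (n + 1)).prod (polarAngleMeasure n)) := by
  refine Measure.ext_of_lintegral _ fun F hF => ?_
  rw [lintegral_map hF (by fun_prop), lintegral_smul_measure, lintegral_map hF (by fun_prop),
    lintegral_norm_inner hV he hF, smul_eq_mul]

theorem measurePreserving_prodProdProdComm {α β γ δ : Type*} [MeasurableSpace α]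
    [MeasurableSpace β] [MeasurableSpace γ] [MeasurableSpace δ] (μa : Measure α) (μb : Measure β)
    (μc : Measure γ) (μd : Measure δ) [SFinite μa] [SFinite μb] [SFinite μc] [SFinite μd] :
    MeasurePreserving (fun p : (α × γ) × (β × δ) => ((p.1.1, p.2.1), (p.1.2, p.2.2)))
      ((μa.prod μc).prod (μb.prod μd)) ((μa.prod μb).prod (μc.prod μd)) := by
  have h1 := measurePreserving_prodAssoc μa μc (μb.prod μd)
  have h2 := (MeasurePreserving.id μa).prod (measurePreserving_prodAssoc μc μb μd).symm
  have h3 := (MeasurePreserving.id μa).prod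
    ((Measure.measurePreserving_swap (μ := μc) (ν := μb)).prod (MeasurePreserving.id μd))
  have h4 := (MeasurePreserving.id μa).prod (measurePreserving_prodAssoc μb μc μd)
  have h5 := (measurePreserving_prodAssoc μa μb (μc.prod μd)).symm
  exact h5.comp (h4.comp (h3.comp (h2.comp h1)))

/-! ### The quarter disk and the slicing of `σ̂`. -/

/-- The measure `(r s) ^ k dr ds` on the quarter disk `{r, s > 0, r² + s² < 1}`. -/
def quarterDiskMeasure (k : ℕ) : Measure (ℝ × ℝ) :=
  ((radialMeasure k).prod (radialMeasure k)).restrict {p | p.1 ^ 2 + p.2 ^ 2 < 1}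

theorem measurableSet_disk : MeasurableSet {p : ℝ × ℝ | p.1 ^ 2 + p.2 ^ 2 < 1} :=
  measurableSet_lt (by fun_prop) (by fun_prop)

/-- The quarter disk lies in the unit square, which has area one. -/
theorem lintegral_quarterDiskMeasure_le_one (k : ℕ) {f : ℝ × ℝ → ℝ≥0∞} (hf : Measurable f)
    (h : ∀ r s : ℝ, 0 < r → 0 < s → r ^ 2 + s ^ 2 < 1 →
      ENNReal.ofReal (r ^ k) * ENNReal.ofReal (s ^ k) * f (r, s) ≤ 1) :
    ∫⁻ p, f p ∂quarterDiskMeasure k ≤ 1 := by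
  rw [quarterDiskMeasure, radialMeasure, prod_withDensity (by fun_prop) (by fun_prop),
    Measure.prod_restrict, ← Measure.volume_eq_prod, ← lintegral_indicator measurableSet_disk,
    lintegral_withDensity_eq_lintegral_mul _ (by fun_prop) (hf.indicator measurableSet_disk),
    ← lintegral_indicator (measurableSet_Ioi.prod measurableSet_Ioi)]
  calc _ ≤ ∫⁻ p : ℝ × ℝ, (Set.Ioo (0 : ℝ) 1 ×ˢ Set.Ioo (0 : ℝ) 1).indicator 1 p := by
        refine lintegral_mono fun p => ?_
        by_cases hp : p ∈ Set.Ioi (0 : ℝ) ×ˢ Set.Ioi (0 : ℝ)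
        · rw [Set.indicator_of_mem hp, Pi.mul_apply]
          by_cases hd : p ∈ {p : ℝ × ℝ | p.1 ^ 2 + p.2 ^ 2 < 1}
          · have h1 : p.1 ^ 2 + p.2 ^ 2 < 1 := hd
            have h2 : 0 < p.1 := hp.1
            have h3 : 0 < p.2 := hp.2
            rw [Set.indicator_of_mem hd, Set.indicator_of_mem]
            · exact h p.1 p.2 h2 h3 h1
            · exact ⟨⟨h2, by nlinarith⟩, ⟨h3, by nlinarith⟩⟩
          · rw [Set.indicator_of_notMem hd, mul_zero]
            exact zero_le
        · rw [Set.indicator_of_notMem hp]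
          exact zero_le
    _ = 1 := by
        rw [lintegral_indicator_one (measurableSet_Ioo.prod measurableSet_Ioo),
          Measure.volume_eq_prod, Measure.prod_prod]
        simp

instance (k : ℕ) : IsFiniteMeasure (quarterDiskMeasure k) where
  measure_univ_lt_top := by
    rw [← lintegral_one]
    refine (lintegral_quarterDiskMeasure_le_one k measurable_const
      fun r s hr hs hrs => ?_).trans_lt ENNReal.one_lt_top
    have h1 : r ≤ 1 := by nlinarith
    have h2 : s ≤ 1 := by nlinarith
    rw [mul_one]
    exact mul_le_one' (ENNReal.ofReal_le_one.2 (pow_le_one₀ hr.le h1))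
      (ENNReal.ofReal_le_one.2 (pow_le_one₀ hs.le h2))

theorem integral_polarAngleMeasure (n : ℕ) (l : ℝ) :
    ∫ θ, Complex.exp (-(l * Real.cos θ : ℝ) * Complex.I) ∂polarAngleMeasure n =
      cosOscillatory (fun θ => (Real.sin θ : ℂ) ^ n) l := by
  rw [polarAngleMeasure, integral_withDensity_eq_integral_toReal_smul (by fun_prop) (by simp),
    cosOscillatory, intervalIntegral.integral_of_le Real.pi_pos.le, integral_Ioc_eq_integral_Ioo]
  refine setIntegral_congr_fun measurableSet_Ioo fun θ hθ => ?_
  have : 0 ≤ Real.sin θ := (Real.sin_pos_of_pos_of_lt_pi hθ.1 hθ.2).le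
  rw [ENNReal.toReal_ofReal (by positivity), Complex.real_smul, Complex.ofReal_pow]

/-- The integrand over the ball, in terms of the norms and of one coordinate of each factor. -/
def ballKernel (A B : ℝ) (q : (ℝ × ℝ) × (ℝ × ℝ)) : ℂ :=
  {p : ℝ × ℝ | p.1 ^ 2 + p.2 ^ 2 < 1}.indicator
    (fun p => Complex.exp (-(2 * Real.pi * (A * q.1.2 + B * q.2.2) / √(p.1 ^ 2 + p.2 ^ 2) : ℝ) *
      Complex.I)) (q.1.1, q.2.1)

theorem measurable_ballKernel (A B : ℝ) : Measurable (ballKernel A B) := by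
  have : ballKernel A B = ((fun q : (ℝ × ℝ) × (ℝ × ℝ) => (q.1.1, q.2.1)) ⁻¹'
      {p : ℝ × ℝ | p.1 ^ 2 + p.2 ^ 2 < 1}).indicator
      (fun q => Complex.exp (-(2 * Real.pi * (A * q.1.2 + B * q.2.2) /
        √(q.1.1 ^ 2 + q.2.1 ^ 2) : ℝ) * Complex.I)) := by
    ext q
    simp [ballKernel, Set.indicator]
  rw [this]
  refine Measurable.indicator (by fun_prop) (measurableSet_disk.preimage (by fun_prop))

/-- Once the two radii are fixed, the exponential is a product of functions of the two angles, and
the disk condition does not involve the angles. Regrouping radii with radii and angles with angles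
lets Fubini produce two factors `J`. -/
theorem integral_ballKernel (n : ℕ) (A B : ℝ) :
    ∫ q, ballKernel A B ((q.1.1, q.1.1 * Real.cos q.1.2), (q.2.1, q.2.1 * Real.cos q.2.2))
      ∂((radialMeasure (n + 1)).prod (polarAngleMeasure n)).prod
        ((radialMeasure (n + 1)).prod (polarAngleMeasure n)) =
    ∫ p, cosOscillatory (fun θ => (Real.sin θ : ℂ) ^ n)
          (2 * Real.pi * A * (p.1 / √(p.1 ^ 2 + p.2 ^ 2))) *
        cosOscillatory (fun θ => (Real.sin θ : ℂ) ^ n)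
          (2 * Real.pi * B * (p.2 / √(p.1 ^ 2 + p.2 ^ 2))) ∂quarterDiskMeasure (n + 1) := by
  set R := radialMeasure (n + 1)
  set Θ := polarAngleMeasure n
  set k : (ℝ × ℝ) × (ℝ × ℝ) → ℂ := fun q =>
    Complex.exp (-(2 * Real.pi * A * (q.1.1 / √(q.1.1 ^ 2 + q.1.2 ^ 2)) * Real.cos q.2.1 : ℝ) *
      Complex.I) *
    Complex.exp (-(2 * Real.pi * B * (q.1.2 / √(q.1.1 ^ 2 + q.1.2 ^ 2)) * Real.cos q.2.2 : ℝ) *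
      Complex.I) with hk
  have hkm : Measurable k := by fun_prop
  have hmp := measurePreserving_prodProdProdComm R R Θ Θ
  have h1 : ∀ q : (ℝ × ℝ) × (ℝ × ℝ),
      ballKernel A B ((q.1.1, q.1.1 * Real.cos q.1.2), (q.2.1, q.2.1 * Real.cos q.2.2)) =
      ({p : ℝ × ℝ | p.1 ^ 2 + p.2 ^ 2 < 1} ×ˢ Set.univ).indicator k
        ((q.1.1, q.2.1), (q.1.2, q.2.2)) := by
    intro q
    by_cases h : q.1.1 ^ 2 + q.2.1 ^ 2 < 1
    · rw [ballKernel, Set.indicator_of_mem (by exact h), Set.indicator_of_mem (by simpa using h)]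
      simp only [hk]
      rw [← Complex.exp_add]
      congr 1
      push_cast
      ring
    · rw [ballKernel, Set.indicator_of_notMem (by exact h),
        Set.indicator_of_notMem (by simpa using h)]
  have hms : MeasurableSet ({p : ℝ × ℝ | p.1 ^ 2 + p.2 ^ 2 < 1} ×ˢ (Set.univ : Set (ℝ × ℝ))) :=
    measurableSet_disk.prod .univ
  simp_rw [h1]
  rw [← integral_map (φ := fun q : (ℝ × ℝ) × (ℝ × ℝ) => ((q.1.1, q.2.1), (q.1.2, q.2.2)))
    (f := ({p : ℝ × ℝ | p.1 ^ 2 + p.2 ^ 2 < 1} ×ˢ Set.univ).indicator k)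
    (by fun_prop) (hkm.indicator hms).aestronglyMeasurable, hmp.map_eq,
    integral_indicator hms, ← Measure.restrict_prod_eq_prod_univ]
  change ∫ q, k q ∂(quarterDiskMeasure (n + 1)).prod (Θ.prod Θ) = _
  rw [integral_prod]
  · refine integral_congr_ae (Filter.Eventually.of_forall fun p => ?_)
    simp only [hk]
    rw [← integral_polarAngleMeasure, ← integral_polarAngleMeasure, ← integral_prod_mul]
  · refine Integrable.of_bound hkm.aestronglyMeasurable 1 (Filter.Eventually.of_forall fun q => ?_)
    simp only [hk]
    rw [norm_mul, ← Complex.ofReal_neg, ← Complex.ofReal_neg, Complex.norm_exp_ofReal_mul_I,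
      Complex.norm_exp_ofReal_mul_I, mul_one]

theorem exists_unit_smul_eq {V : Type*} [NormedAddCommGroup V] [NormedSpace ℝ V] [Nontrivial V]
    (x : V) : ∃ e : V, ‖e‖ = 1 ∧ x = ‖x‖ • e := by
  rcases eq_or_ne x 0 with rfl | hx
  · obtain ⟨e, he⟩ := exists_norm_eq V zero_le_one
    exact ⟨e, he, by simp⟩
  · refine ⟨‖x‖⁻¹ • x, norm_smul_inv_norm hx, ?_⟩
    rw [smul_inv_smul₀ (norm_ne_zero_iff.2 hx)]

/-- The slicing formula for the Fourier transform of the surface measure. -/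
theorem exists_sphereMeasureHat_eq (n : ℕ) :
    ∃ c : ℝ, ∀ ξ η : E (n + 2), sphereMeasureHat (n + 2) ξ η =
      c * ∫ p, cosOscillatory (fun θ => (Real.sin θ : ℂ) ^ n)
          (2 * Real.pi * ‖ξ‖ * (p.1 / √(p.1 ^ 2 + p.2 ^ 2))) *
        cosOscillatory (fun θ => (Real.sin θ : ℂ) ^ n)
          (2 * Real.pi * ‖η‖ * (p.2 / √(p.1 ^ 2 + p.2 ^ 2))) ∂quarterDiskMeasure (n + 1) := by
  -- The factors are the normalization of `σ`, the dimension `2(n + 2)` from passing between ball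
  -- and sphere, and one area of `S^n` for each orthogonal complement of a direction.
  refine ⟨(((volume : Measure (E2 (n + 2))).toSphere Set.univ)⁻¹).toReal *
    Module.finrank ℝ (E2 (n + 2)) * (sphereArea n * sphereArea n).toReal, fun ξ η => ?_⟩
  -- If `ξ = 0`, any unit vector serves as `e`, so no separate case is needed.
  obtain ⟨e, he, hξ⟩ := exists_unit_smul_eq ξ
  obtain ⟨e', he', hη⟩ := exists_unit_smul_eq η
  have hfin : Module.finrank ℝ (E (n + 2)) = n + 2 := finrank_euclideanSpace_fin
  set h : E2 (n + 2) → ℂ := fun w => Complex.exp (-2 * Real.pi * Complex.I *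
      ((⟪w.fst, ξ⟫ + ⟪w.snd, η⟫ : ℝ) : ℂ)) with hh
  have hball : ∫ x in Metric.ball (0 : E2 (n + 2)) 1, h (‖x‖⁻¹ • x) =
      ∫ p : E (n + 2) × E (n + 2),
        ballKernel ‖ξ‖ ‖η‖ ((‖p.1‖, ⟪p.1, e⟫), (‖p.2‖, ⟪p.2, e'⟫)) := by
    rw [← integral_indicator measurableSet_ball,
      ← (WithLp.volume_preserving_toLp (E (n + 2)) (E (n + 2))).integral_comp
        (MeasurableEquiv.toLp 2 (E (n + 2) × E (n + 2))).measurableEmbedding]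
    refine integral_congr_ae (Filter.Eventually.of_forall fun p => ?_)
    have hN : ‖WithLp.toLp 2 p‖ = √(‖p.1‖ ^ 2 + ‖p.2‖ ^ 2) := WithLp.prod_norm_eq_of_L2 _
    have hiff : ‖WithLp.toLp 2 p‖ < 1 ↔ ‖p.1‖ ^ 2 + ‖p.2‖ ^ 2 < 1 := by
      rw [hN, Real.sqrt_lt' one_pos, one_pow]
    by_cases hp : ‖p.1‖ ^ 2 + ‖p.2‖ ^ 2 < 1
    · simp only
      rw [Set.indicator_of_mem (by simpa using hiff.2 hp), ballKernel,
        Set.indicator_of_mem (by exact hp)]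
      simp only [hh]
      congr 1
      have e1 : ⟪(‖WithLp.toLp 2 p‖⁻¹ • WithLp.toLp 2 p).fst, ξ⟫ =
          ‖WithLp.toLp 2 p‖⁻¹ * (‖ξ‖ * ⟪p.1, e⟫) := by
        rw [WithLp.smul_fst, real_inner_smul_left]
        nth_rw 1 [hξ]
        rw [real_inner_smul_right]
        rfl
      have e2 : ⟪(‖WithLp.toLp 2 p‖⁻¹ • WithLp.toLp 2 p).snd, η⟫ =
          ‖WithLp.toLp 2 p‖⁻¹ * (‖η‖ * ⟪p.2, e'⟫) := by
        rw [WithLp.smul_snd, real_inner_smul_left]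
        nth_rw 1 [hη]
        rw [real_inner_smul_right]
        rfl
      rw [e1, e2, hN]
      push_cast
      ring
    · simp only
      rw [Set.indicator_of_notMem (by simpa using fun h' => hp (hiff.1 h')), ballKernel,
        Set.indicator_of_notMem (by exact hp)]
  have hmap : ∫ p : E (n + 2) × E (n + 2),
        ballKernel ‖ξ‖ ‖η‖ ((‖p.1‖, ⟪p.1, e⟫), (‖p.2‖, ⟪p.2, e'⟫)) =
      (sphereArea n * sphereArea n).toReal • ∫ q, ballKernel ‖ξ‖ ‖η‖
          ((q.1.1, q.1.1 * Real.cos q.1.2), (q.2.1, q.2.1 * Real.cos q.2.2))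
        ∂((radialMeasure (n + 1)).prod (polarAngleMeasure n)).prod
          ((radialMeasure (n + 1)).prod (polarAngleMeasure n)) := by
    have hm := measurable_ballKernel ‖ξ‖ ‖η‖
    calc _ = ∫ q, ballKernel ‖ξ‖ ‖η‖ q ∂Measure.map
            (Prod.map (fun y : E (n + 2) => (‖y‖, ⟪y, e⟫)) (fun y : E (n + 2) => (‖y‖, ⟪y, e'⟫)))
            (volume.prod volume) := by
          rw [integral_map (by fun_prop) hm.aestronglyMeasurable]; rfl
      _ = _ := by
          rw [← Measure.map_prod_map _ _ (by fun_prop) (by fun_prop), map_norm_inner_volume hfin he,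
            map_norm_inner_volume hfin he', Measure.prod_smul_left, Measure.prod_smul_right,
            smul_smul, integral_smul_measure,
            Measure.map_prod_map _ _ (by fun_prop) (by fun_prop),
            integral_map (by fun_prop) hm.aestronglyMeasurable]
          rfl
  rw [sphereMeasureHat, sphereMeasure, integral_smul_measure]
  rw [← setIntegral_ball_inv_norm_smul volume h, hball, hmap, integral_ballKernel]
  simp only [Complex.real_smul]
  push_cast
  ring


/-! ### The inverse Fourier integral on `L¹ ∩ L²`. -/

section Plancherel

variable {V : Type*} [NormedAddCommGroup V] [InnerProductSpace ℝ V] [MeasurableSpace V]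
  [BorelSpace V] [FiniteDimensional ℝ V]

theorem continuous_fourierInv {F : V → ℂ} (hF : Integrable F) : Continuous (𝓕⁻ F) := by
  have h := VectorFourier.fourierIntegral_continuous Real.continuous_fourierChar
    (L := -innerₗ V) (by exact continuous_inner.neg) hF
  exact h

/-- Both sides are locally integrable, so it is enough to pair them with test functions. Either
pairing moves the transform onto the test function: by Fubini for the integral, by compatibility
with tempered distributions for the `L²` extension. -/
theorem fourierInv_ae_eq_fourierInv_toLp {F : V → ℂ} (hF : Integrable F) (hF2 : MemLp F 2) :
    𝓕⁻ F =ᵐ[volume] ((𝓕⁻ (hF2.toLp F) : Lp ℂ 2 (volume : Measure V)) : V → ℂ) := by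
  refine ae_eq_of_integral_contDiff_smul_eq (continuous_fourierInv hF).locallyIntegrable
    ((Lp.memLp _).locallyIntegrable (by norm_num)) fun g g_smooth g_cpt => ?_
  have hg₁ : HasCompactSupport (Complex.ofRealCLM ∘ g) := g_cpt.comp_left rfl
  have hg₂ : ContDiff ℝ ((⊤ : ℕ∞) : WithTop ℕ∞) (Complex.ofRealCLM ∘ g) := by fun_prop
  set G : 𝓢(V, ℂ) := hg₁.toSchwartzMap hg₂ with hG
  have hGg : ∀ x, G x = (g x : ℂ) := fun x => rfl
  have hflip : ∫ ξ, (𝓕⁻ (G : V → ℂ)) ξ • F ξ = ∫ x, G x • (𝓕⁻ F) x := by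
    have := VectorFourier.integral_fourierIntegral_smul_eq_flip (L := -innerₗ V)
      (μ := volume) (ν := volume)
      Real.continuous_fourierChar (by exact continuous_inner.neg) G.integrable hF
    have hL : (-innerₗ V).flip = -innerₗ V := by
      ext x y; simp [real_inner_comm]
    rw [hL] at this
    exact this
  calc ∫ x, g x • (𝓕⁻ F) x = ∫ x, G x • (𝓕⁻ F) x := by simp [hGg]
    _ = ∫ ξ, (𝓕⁻ G) ξ • F ξ := by rw [← hflip, fourierInv_coe]
    _ = Lp.toTemperedDistribution (hF2.toLp F) (𝓕⁻ G) := by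
        rw [Lp.toTemperedDistribution_apply]
        refine integral_congr_ae ?_
        filter_upwards [hF2.coeFn_toLp] with x hx
        rw [hx]
    _ = Lp.toTemperedDistribution (𝓕⁻ (hF2.toLp F)) G := by
        rw [← Lp.fourierInv_toTemperedDistribution_eq, TemperedDistribution.fourierInv_apply]
    _ = _ := by
        rw [Lp.toTemperedDistribution_apply]
        simp [hGg]

/-- Plancherel for the inverse Fourier integral of functions in `L¹ ∩ L²`. -/
theorem eLpNorm_fourierInv_eq {F : V → ℂ} (hF : Integrable F) (hF2 : MemLp F 2) :
    eLpNorm (𝓕⁻ F) 2 volume = eLpNorm F 2 volume := by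
  have hn : ‖(𝓕⁻ (hF2.toLp F) : Lp ℂ 2 (volume : Measure V))‖ = ‖hF2.toLp F‖ :=
    (Lp.fourierTransformₗᵢ V ℂ).symm.norm_map _
  rw [eLpNorm_congr_ae (fourierInv_ae_eq_fourierInv_toLp hF hF2), ← Lp.enorm_def,
    ← ofReal_norm, hn, ofReal_norm, Lp.enorm_toLp]

theorem fourierInv_eq_integral_exp (F : V → ℂ) (x : V) :
    (𝓕⁻ F) x = ∫ ξ, F ξ * Complex.exp (2 * Real.pi * Complex.I * (⟪x, ξ⟫ : ℝ)) := by
  rw [Real.fourierInv_eq']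
  refine integral_congr_ae (Filter.Eventually.of_forall fun ξ => ?_)
  simp only [smul_eq_mul, real_inner_comm ξ x]
  rw [mul_comm]
  push_cast
  ring_nf

end Plancherel


/-! ### Bilinear multipliers averaged from tensor products. -/

section TensorMultiplier

variable {V P : Type*} [NormedAddCommGroup V] [InnerProductSpace ℝ V] [MeasurableSpace V]
  [BorelSpace V] [FiniteDimensional ℝ V] [MeasurableSpace P]

/-- The integrand of the bilinear multiplier operator whose symbol is the average
`∫ a(p, ξ) b(p, η) dQ(p)` of tensor products. -/
def tensorIntegrand {W : Type*} [NormedAddCommGroup W] [InnerProductSpace ℝ W]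
    (Q : Measure P) (a b : P × W → ℂ) (F G : W → ℂ) (x : W) (q : W × W) : ℂ :=
  F q.1 * G q.2 * (∫ p, a (p, q.1) * b (p, q.2) ∂Q) *
    Complex.exp (2 * Real.pi * Complex.I * (⟪x, q.1 + q.2⟫ : ℝ))

theorem tensorIntegrand_eq_integral {W : Type*} [NormedAddCommGroup W] [InnerProductSpace ℝ W]
    (Q : Measure P) (a b : P × W → ℂ) (F G : W → ℂ) (x : W) (q : W × W) :
    tensorIntegrand Q a b F G x q =
      ∫ p, (F q.1 * a (p, q.1) * Complex.exp (2 * Real.pi * Complex.I * (⟪x, q.1⟫ : ℝ))) *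
        (G q.2 * b (p, q.2) * Complex.exp (2 * Real.pi * Complex.I * (⟪x, q.2⟫ : ℝ))) ∂Q := by
  rw [tensorIntegrand, inner_add_right, Complex.ofReal_add, mul_add, Complex.exp_add,
    ← integral_const_mul, ← integral_mul_const]
  refine integral_congr_ae (Filter.Eventually.of_forall fun p => ?_)
  simp only
  ring

theorem norm_exp_two_pi_I_mul (t : ℝ) :
    ‖Complex.exp (2 * Real.pi * Complex.I * (t : ℝ))‖ = 1 := by
  rw [show (2 * Real.pi * Complex.I * (t : ℝ) : ℂ) = ((2 * Real.pi * t : ℝ) : ℂ) * Complex.I by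
    push_cast; ring, Complex.norm_exp_ofReal_mul_I]

variable {Q : Measure P} [IsFiniteMeasure Q] {a b : P × V → ℂ} {F G : V → ℂ} {K : ℝ}

/-- This licenses every use of Fubini between frequency and the parameter `p`: the slices are
bounded and `Q` is finite. -/
theorem integrable_tensor_uncurry (ha : Measurable a) (hb : Measurable b)
    (haK : ∀ z, ‖a z‖ ≤ K) (hbK : ∀ z, ‖b z‖ ≤ K) (hF : Integrable F) (hG : Integrable G)
    (hFm : Measurable F) (hGm : Measurable G) (x : V) :
    Integrable (fun z : (V × V) × P =>
      (F z.1.1 * a (z.2, z.1.1) * Complex.exp (2 * Real.pi * Complex.I * (⟪x, z.1.1⟫ : ℝ))) *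
      (G z.1.2 * b (z.2, z.1.2) * Complex.exp (2 * Real.pi * Complex.I * (⟪x, z.1.2⟫ : ℝ))))
      ((volume : Measure (V × V)).prod Q) := by
  have h1 : Integrable (fun z : (V × V) × P => (F z.1.1 * G z.1.2) * ((K * K : ℝ) : ℂ))
      ((volume : Measure (V × V)).prod Q) :=
    (hF.mul_prod hG).mul_prod (integrable_const _)
  refine h1.mono (Measurable.aestronglyMeasurable (by fun_prop))
    (Filter.Eventually.of_forall fun z => ?_)
  have hK : 0 ≤ K := (norm_nonneg _).trans (haK (z.2, z.1.1))
  simp only [norm_mul, norm_exp_two_pi_I_mul, mul_one, Complex.norm_real, Real.norm_eq_abs,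
    abs_of_nonneg hK]
  calc ‖F z.1.1‖ * ‖a (z.2, z.1.1)‖ * (‖G z.1.2‖ * ‖b (z.2, z.1.2)‖)
      ≤ ‖F z.1.1‖ * K * (‖G z.1.2‖ * K) := by
        gcongr
        · exact haK _
        · exact hbK _
    _ = _ := by ring

theorem integrable_tensorIntegrand (ha : Measurable a) (hb : Measurable b)
    (haK : ∀ z, ‖a z‖ ≤ K) (hbK : ∀ z, ‖b z‖ ≤ K) (hF : Integrable F) (hG : Integrable G)
    (hFm : Measurable F) (hGm : Measurable G) (x : V) :
    Integrable (tensorIntegrand Q a b F G x) := by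
  have := (integrable_tensor_uncurry (Q := Q) ha hb haK hbK hF hG hFm hGm x).integral_prod_left
  refine this.congr (Filter.Eventually.of_forall fun q => ?_)
  rw [tensorIntegrand_eq_integral]

theorem integral_tensorIntegrand (ha : Measurable a) (hb : Measurable b)
    (haK : ∀ z, ‖a z‖ ≤ K) (hbK : ∀ z, ‖b z‖ ≤ K) (hF : Integrable F) (hG : Integrable G)
    (hFm : Measurable F) (hGm : Measurable G) (x : V) :
    ∫ q, tensorIntegrand Q a b F G x q =
      ∫ p, (𝓕⁻ (fun ξ => F ξ * a (p, ξ))) x * (𝓕⁻ (fun ξ => G ξ * b (p, ξ))) x ∂Q := by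
  simp_rw [tensorIntegrand_eq_integral]
  rw [integral_integral_swap (integrable_tensor_uncurry ha hb haK hbK hF hG hFm hGm x)]
  refine integral_congr_ae (Filter.Eventually.of_forall fun p => ?_)
  simp only
  rw [fourierInv_eq_integral_exp, fourierInv_eq_integral_exp, ← integral_prod_mul]
  rfl

theorem stronglyMeasurable_fourierInv_param (ha : Measurable a) (hFm : Measurable F) :
    StronglyMeasurable fun z : V × P => (𝓕⁻ (fun ξ => F ξ * a (z.2, ξ))) z.1 := by
  simp_rw [fourierInv_eq_integral_exp]
  exact StronglyMeasurable.integral_prod_right' (f := fun w : (V × P) × V =>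
    F w.2 * a (w.1.2, w.2) * Complex.exp (2 * Real.pi * Complex.I * (⟪w.1.1, w.2⟫ : ℝ)))
    (Measurable.stronglyMeasurable (by fun_prop))

theorem stronglyMeasurable_integral_tensorIntegrand (ha : Measurable a) (hb : Measurable b)
    (haK : ∀ z, ‖a z‖ ≤ K) (hbK : ∀ z, ‖b z‖ ≤ K) (hF : Integrable F) (hG : Integrable G)
    (hFm : Measurable F) (hGm : Measurable G) :
    StronglyMeasurable fun x => ∫ q, tensorIntegrand Q a b F G x q := by
  simp_rw [integral_tensorIntegrand ha hb haK hbK hF hG hFm hGm]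
  exact StronglyMeasurable.integral_prod_right' (ν := Q) (f := fun z : V × P =>
    (𝓕⁻ (fun ξ => F ξ * a (z.2, ξ))) z.1 * (𝓕⁻ (fun ξ => G ξ * b (z.2, ξ))) z.1)
    ((stronglyMeasurable_fourierInv_param ha hFm).mul (stronglyMeasurable_fourierInv_param hb hGm))

theorem lintegral_enorm_mul_le_eLpNorm_two {A B : V → ℂ} (hA : AEStronglyMeasurable A volume)
    (hB : AEStronglyMeasurable B volume) :
    ∫⁻ x, ‖A x * B x‖ₑ ≤ eLpNorm A 2 volume * eLpNorm B 2 volume := by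
  have h := ENNReal.lintegral_mul_le_Lp_mul_Lq volume Real.HolderConjugate.two_two
    hA.enorm hB.enorm
  rw [eLpNorm_eq_lintegral_rpow_enorm_toReal two_ne_zero ENNReal.ofNat_ne_top,
    eLpNorm_eq_lintegral_rpow_enorm_toReal two_ne_zero ENNReal.ofNat_ne_top]
  simpa only [Pi.mul_apply, enorm_mul, ENNReal.toReal_ofNat] using h

theorem lintegral_enorm_fourierInv_mul_le (hF : Integrable F) (hG : Integrable G)
    (hF2 : MemLp F 2) (hG2 : MemLp G 2) :
    ∫⁻ x, ‖(𝓕⁻ F) x * (𝓕⁻ G) x‖ₑ ≤ eLpNorm F 2 volume * eLpNorm G 2 volume := by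
  rw [← eLpNorm_fourierInv_eq hF hF2, ← eLpNorm_fourierInv_eq hG hG2]
  exact lintegral_enorm_mul_le_eLpNorm_two (continuous_fourierInv hF).aestronglyMeasurable
    (continuous_fourierInv hG).aestronglyMeasurable

theorem memLp_mul_of_norm_le {r : ℝ≥0∞} (ha : Measurable a) (haK : ∀ z, ‖a z‖ ≤ K)
    (hF : MemLp F r) (p : P) : MemLp (fun ξ => F ξ * a (p, ξ)) r :=
  hF.of_le_mul (hF.aestronglyMeasurable.mul (ha.comp measurable_prodMk_left).aestronglyMeasurable)
    (Filter.Eventually.of_forall fun ξ => by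
      rw [norm_mul, mul_comm]; exact mul_le_mul_of_nonneg_right (haK _) (norm_nonneg _))

/-- The triangle inequality and Tonelli reduce to one `p` at a time; there the function is a product
of two inverse Fourier transforms, handled by Cauchy–Schwarz and Plancherel. -/
theorem eLpNorm_integral_tensorIntegrand_le (ha : Measurable a) (hb : Measurable b)
    (haK : ∀ z, ‖a z‖ ≤ K) (hbK : ∀ z, ‖b z‖ ≤ K) (hF : Integrable F) (hG : Integrable G)
    (hFm : Measurable F) (hGm : Measurable G) (hF2 : MemLp F 2) (hG2 : MemLp G 2) :
    eLpNorm (fun x => ∫ q, tensorIntegrand Q a b F G x q) 1 volume ≤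
      ∫⁻ p, eLpNorm (fun ξ => F ξ * a (p, ξ)) 2 volume *
        eLpNorm (fun ξ => G ξ * b (p, ξ)) 2 volume ∂Q := by
  have hA := stronglyMeasurable_fourierInv_param (P := P) ha hFm
  have hB := stronglyMeasurable_fourierInv_param (P := P) hb hGm
  simp_rw [integral_tensorIntegrand ha hb haK hbK hF hG hFm hGm]
  rw [eLpNorm_one_eq_lintegral_enorm]
  calc _ ≤ ∫⁻ x : V, ∫⁻ p, ‖(𝓕⁻ (fun ξ => F ξ * a (p, ξ))) x *
          (𝓕⁻ (fun ξ => G ξ * b (p, ξ))) x‖ₑ ∂Q :=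
        lintegral_mono fun x => by exact enorm_integral_le_lintegral_enorm _
    _ = ∫⁻ p, (∫⁻ x : V, ‖(𝓕⁻ (fun ξ => F ξ * a (p, ξ))) x *
          (𝓕⁻ (fun ξ => G ξ * b (p, ξ))) x‖ₑ) ∂Q :=
        lintegral_lintegral_swap (hA.mul hB).enorm.aemeasurable
    _ ≤ _ := by
        refine lintegral_mono fun p => ?_
        rw [← memLp_one_iff_integrable] at hF hG
        exact lintegral_enorm_fourierInv_mul_le
          (memLp_one_iff_integrable.1 (memLp_mul_of_norm_le ha haK hF p))
          (memLp_one_iff_integrable.1 (memLp_mul_of_norm_le hb hbK hG p))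
          (memLp_mul_of_norm_le ha haK hF2 p) (memLp_mul_of_norm_le hb hbK hG2 p)

end TensorMultiplier


/-! ### Frequency localization and summation over the slices. -/

theorem continuous_cosOscillatory {W : ℝ → ℂ} (hW : Continuous W) :
    Continuous (cosOscillatory W) :=
  continuous_iff_continuousAt.2 fun l => (hasDerivAt_cosOscillatory hW l).continuousAt

theorem exists_norm_cosOscillatory_le_rpow (n : ℕ) :
    ∃ C : ℝ, 0 ≤ C ∧ ∀ l, 0 < l →
      ‖cosOscillatory (fun θ => (Real.sin θ : ℂ) ^ n) l‖ ≤ C * l ^ (-(((n : ℝ) + 1) / 2)) := by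
  obtain ⟨C, hC⟩ := exists_pow_mul_norm_sq_cosOscillatory_le n
  refine ⟨√C, Real.sqrt_nonneg _, fun l hl => ?_⟩
  set N := ‖cosOscillatory (fun θ => (Real.sin θ : ℂ) ^ n) l‖
  have hpos : 0 < l ^ (((n : ℝ) + 1) / 2) := Real.rpow_pos_of_pos hl _
  have hsq : (l ^ (((n : ℝ) + 1) / 2)) ^ 2 = l ^ (n + 1) := by
    rw [← Real.rpow_natCast, ← Real.rpow_mul hl.le, ← Real.rpow_natCast]
    congr 1
    push_cast
    ring
  rw [Real.rpow_neg hl.le, ← div_eq_mul_inv, le_div_iff₀ hpos]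
  refine Real.le_sqrt_of_sq_le ?_
  rw [mul_pow, hsq, mul_comm]
  exact hC l hl

variable {d : ℕ} {φ : 𝓢(E d, ℂ)}

theorem continuous_psiHat : Continuous (psiHat φ) := by
  unfold psiHat
  have := (𝓕 φ).continuous
  fun_prop

theorem exists_norm_psiHat_le (φ : 𝓢(E d, ℂ)) : ∃ K : ℝ, 0 ≤ K ∧ ∀ ξ, ‖psiHat φ ξ‖ ≤ K := by
  obtain ⟨C, -, hC⟩ := (𝓕 φ).decay 0 0
  have h : ∀ ξ, ‖(𝓕 φ) ξ‖ ≤ C := fun ξ => by simpa using hC ξ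
  exact ⟨C + C, (norm_nonneg (psiHat φ 0)).trans ((norm_sub_le _ _).trans (add_le_add (h _) (h _))),
    fun ξ => (norm_sub_le _ _).trans (add_le_add (h _) (h _))⟩

theorem IsLowFrequencyBump.psiHat_eq_zero_of_le (hφ : IsLowFrequencyBump φ) {ξ : E d}
    (h : ‖ξ‖ ≤ 1 / 2) : psiHat φ ξ = 0 := by
  rw [psiHat, hφ.fourier_eq_one ξ (by linarith), hφ.fourier_eq_one _ (by
    rw [norm_smul, Real.norm_ofNat]; linarith), sub_self]

theorem IsLowFrequencyBump.psiHat_eq_zero_of_ge (hφ : IsLowFrequencyBump φ) {ξ : E d}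
    (h : 2 ≤ ‖ξ‖) : psiHat φ ξ = 0 := by
  rw [psiHat, hφ.fourier_eq_zero ξ h, hφ.fourier_eq_zero _ (by
    rw [norm_smul, Real.norm_ofNat]; linarith), sub_self]

/-- The frequency localization `f̂(ξ) ψ̂(2^{-i} ξ)`. -/
def localizedHat (φ : 𝓢(E d, ℂ)) (i : ℕ) (f : Lp ℂ 2 (volume : Measure (E d))) (ξ : E d) : ℂ :=
  (𝓕 f : Lp ℂ 2 (volume : Measure (E d))) ξ * psiHat φ ((2 : ℝ) ^ (-(i : ℤ)) • ξ)

theorem measurable_localizedHat (i : ℕ) (f : Lp ℂ 2 (volume : Measure (E d))) :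
    Measurable (localizedHat φ i f) :=
  (Lp.stronglyMeasurable _).measurable.mul
    (continuous_psiHat.comp (continuous_const_smul _)).measurable

theorem memLp_localizedHat (i : ℕ) (f : Lp ℂ 2 (volume : Measure (E d))) :
    MemLp (localizedHat φ i f) 2 := by
  obtain ⟨K, -, hK⟩ := exists_norm_psiHat_le φ
  refine (Lp.memLp (𝓕 f)).of_le_mul (c := K) (measurable_localizedHat i f).aestronglyMeasurable
    (Filter.Eventually.of_forall fun ξ => ?_)
  rw [localizedHat, norm_mul, mul_comm]
  exact mul_le_mul_of_nonneg_right (hK _) (norm_nonneg _)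

/-- Compact frequency support upgrades `L²` to `L¹`; the absolute convergence of the integral
defining the piece rests on this. -/
theorem IsLowFrequencyBump.integrable_localizedHat (hφ : IsLowFrequencyBump φ) (i : ℕ)
    (f : Lp ℂ 2 (volume : Measure (E d))) : Integrable (localizedHat φ i f) := by
  have hcont : Continuous fun ξ : E d => psiHat φ ((2 : ℝ) ^ (-(i : ℤ)) • ξ) :=
    continuous_psiHat.comp (continuous_const_smul _)
  have hsupp : HasCompactSupport fun ξ : E d => psiHat φ ((2 : ℝ) ^ (-(i : ℤ)) • ξ) := by
    refine HasCompactSupport.intro (isCompact_closedBall (0 : E d) (2 * 2 ^ i)) fun ξ hξ => ?_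
    refine hφ.psiHat_eq_zero_of_ge ?_
    rw [mem_closedBall_zero_iff, not_le] at hξ
    rw [norm_smul, norm_zpow, Real.norm_ofNat, zpow_neg, zpow_natCast, ← div_eq_inv_mul,
      le_div_iff₀ (by positivity)]
    exact hξ.le
  exact (Lp.memLp (𝓕 f)).integrable_mul (q := 2) (hcont.memLp_of_hasCompactSupport hsupp)

/-- On the support of `ψ̂(2^{-i}·)` one has `|ξ| ≥ 2^{i-1}`, so the argument of `J` is at least `2^i
t` and its decay gives `(2^i t)^{-(n+1)/2}` uniformly in `ξ`. -/
theorem IsLowFrequencyBump.eLpNorm_localizedHat_mul_le (hφ : IsLowFrequencyBump φ) {n : ℕ}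
    {K C : ℝ} (hK0 : 0 ≤ K) (hK : ∀ ξ, ‖psiHat φ ξ‖ ≤ K) (hC0 : 0 ≤ C)
    (hC : ∀ l, 0 < l → ‖cosOscillatory (fun θ => (Real.sin θ : ℂ) ^ n) l‖ ≤
      C * l ^ (-(((n : ℝ) + 1) / 2)))
    (i : ℕ) (f : Lp ℂ 2 (volume : Measure (E d))) {t : ℝ} (ht : 0 < t) :
    eLpNorm (fun ξ => localizedHat φ i f ξ *
        cosOscillatory (fun θ => (Real.sin θ : ℂ) ^ n) (2 * Real.pi * ‖ξ‖ * t)) 2 volume ≤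
      ENNReal.ofReal (K * C * (2 : ℝ) ^ (-((i : ℝ) * (((n : ℝ) + 1) / 2))) * ‖f‖) *
        ENNReal.ofReal (t ^ (-(((n : ℝ) + 1) / 2))) := by
  set m : ℝ := ((n : ℝ) + 1) / 2 with hm
  have hm0 : 0 ≤ m := by positivity
  have hnorm : eLpNorm (𝓕 f : Lp ℂ 2 (volume : Measure (E d))) 2 volume = ENNReal.ofReal ‖f‖ := by
    rw [← Lp.norm_fourier_eq f, ofReal_norm, Lp.enorm_def]
  have hpt : ∀ ξ : E d, ‖localizedHat φ i f ξ *
      cosOscillatory (fun θ => (Real.sin θ : ℂ) ^ n) (2 * Real.pi * ‖ξ‖ * t)‖ ≤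
      (K * C * (2 : ℝ) ^ (-((i : ℝ) * m)) * t ^ (-m)) *
        ‖(𝓕 f : Lp ℂ 2 (volume : Measure (E d))) ξ‖ := by
    intro ξ
    rcases le_total ‖(2 : ℝ) ^ (-(i : ℤ)) • ξ‖ (1 / 2) with h | h
    · rw [localizedHat, hφ.psiHat_eq_zero_of_le h, mul_zero, zero_mul, norm_zero]
      positivity
    · rw [norm_smul, norm_zpow, Real.norm_ofNat, zpow_neg, zpow_natCast, ← div_eq_inv_mul,
        le_div_iff₀ (by positivity)] at h
      have h2 : (2 : ℝ) ^ i * t ≤ 2 * Real.pi * ‖ξ‖ * t := by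
        gcongr
        nlinarith [Real.pi_gt_three, norm_nonneg ξ]
      have h3 : ‖cosOscillatory (fun θ => (Real.sin θ : ℂ) ^ n) (2 * Real.pi * ‖ξ‖ * t)‖ ≤
          C * ((2 : ℝ) ^ (-((i : ℝ) * m)) * t ^ (-m)) := by
        refine (hC _ (lt_of_lt_of_le (by positivity) h2)).trans ?_
        refine mul_le_mul_of_nonneg_left ?_ hC0
        refine (Real.rpow_le_rpow_of_nonpos (by positivity) h2 (by linarith)).trans ?_
        rw [Real.mul_rpow (by positivity) ht.le, ← Real.rpow_natCast, ← Real.rpow_mul (by norm_num),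
          mul_neg]
      rw [localizedHat, norm_mul, norm_mul]
      calc _ ≤ ‖(𝓕 f : Lp ℂ 2 (volume : Measure (E d))) ξ‖ * K *
            (C * ((2 : ℝ) ^ (-((i : ℝ) * m)) * t ^ (-m))) := by
            gcongr
            exact hK _
        _ = _ := by ring
  refine (eLpNorm_le_mul_eLpNorm_of_ae_le_mul (Filter.Eventually.of_forall hpt) 2).trans ?_
  rw [hnorm, ← ENNReal.ofReal_mul (by positivity), ← ENNReal.ofReal_mul (by positivity)]
  refine le_of_eq (congrArg _ ?_)
  ring

/-- The density times the integrand is `(rs)^{n+1} (rs/N²)^{-(n+1)/2} = (rs N²)^{(n+1)/2}`, at most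
one because `2rs ≤ N² < 1`. -/
theorem lintegral_quarterDiskMeasure_rpow_le (n : ℕ) :
    ∫⁻ p : ℝ × ℝ, ENNReal.ofReal ((p.1 / √(p.1 ^ 2 + p.2 ^ 2)) ^ (-(((n : ℝ) + 1) / 2))) *
      ENNReal.ofReal ((p.2 / √(p.1 ^ 2 + p.2 ^ 2)) ^ (-(((n : ℝ) + 1) / 2)))
      ∂quarterDiskMeasure (n + 1) ≤ 1 := by
  refine lintegral_quarterDiskMeasure_le_one _ (by fun_prop) fun r s hr hs hrs => ?_
  set m : ℝ := ((n : ℝ) + 1) / 2 with hm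
  have hm0 : 0 ≤ m := by positivity
  set N : ℝ := √(r ^ 2 + s ^ 2)
  have hN : 0 < N := Real.sqrt_pos.2 (by positivity)
  have hN2 : N ^ 2 = r ^ 2 + s ^ 2 := Real.sq_sqrt (by positivity)
  have hpow : ∀ x : ℝ, 0 < x → x ^ (n + 1) = (x * x) ^ m := by
    intro x hx
    rw [← pow_two, ← Real.rpow_natCast x 2, ← Real.rpow_mul hx.le, ← Real.rpow_natCast]
    congr 1
    push_cast
    ring
  rw [← ENNReal.ofReal_mul (by positivity), ← ENNReal.ofReal_mul (by positivity),
    ← ENNReal.ofReal_mul (by positivity), ENNReal.ofReal_le_one, Real.rpow_neg (by positivity),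
    Real.rpow_neg (by positivity), ← Real.inv_rpow (by positivity), ← Real.inv_rpow (by positivity),
    hpow r hr, hpow s hs, ← Real.mul_rpow (by positivity) (by positivity),
    ← Real.mul_rpow (by positivity) (by positivity), ← Real.mul_rpow (by positivity) (by positivity)]
  refine Real.rpow_le_one (by positivity) ?_ hm0
  have : r * r * (s * s) * ((r / N)⁻¹ * (s / N)⁻¹) = r * s * N ^ 2 := by
    field_simp
  rw [this, hN2]
  nlinarith [mul_pos hr hs, sq_nonneg (r - s)]

theorem ae_quarterDiskMeasure_pos (k : ℕ) : ∀ᵐ p ∂quarterDiskMeasure k, 0 < p.1 ∧ 0 < p.2 := by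
  have h : ∀ᵐ r ∂radialMeasure k, 0 < r :=
    (withDensity_absolutelyContinuous _ _).ae_le (ae_restrict_mem measurableSet_Ioi)
  refine ae_restrict_of_ae ?_
  filter_upwards [Measure.quasiMeasurePreserving_fst.ae h,
    Measure.quasiMeasurePreserving_snd.ae h] with p h1 h2
  exact ⟨h1, h2⟩

/-- Only the majorant needs to be measurable, so measurability in `p` of the `L²` norms of the
slices never has to be shown. -/
theorem lintegral_mul_quarterDiskMeasure_le {n : ℕ} {u v : ℝ × ℝ → ℝ≥0∞} {X Y : ℝ≥0∞}
    (hu : ∀ p : ℝ × ℝ, 0 < p.1 → 0 < p.2 →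
      u p ≤ X * ENNReal.ofReal ((p.1 / √(p.1 ^ 2 + p.2 ^ 2)) ^ (-(((n : ℝ) + 1) / 2))))
    (hv : ∀ p : ℝ × ℝ, 0 < p.1 → 0 < p.2 →
      v p ≤ Y * ENNReal.ofReal ((p.2 / √(p.1 ^ 2 + p.2 ^ 2)) ^ (-(((n : ℝ) + 1) / 2)))) :
    ∫⁻ p, u p * v p ∂quarterDiskMeasure (n + 1) ≤ X * Y := by
  calc _ ≤ ∫⁻ p : ℝ × ℝ, (X * Y) *
        (ENNReal.ofReal ((p.1 / √(p.1 ^ 2 + p.2 ^ 2)) ^ (-(((n : ℝ) + 1) / 2))) *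
        ENNReal.ofReal ((p.2 / √(p.1 ^ 2 + p.2 ^ 2)) ^ (-(((n : ℝ) + 1) / 2))))
        ∂quarterDiskMeasure (n + 1) := by
        refine lintegral_mono_ae ?_
        filter_upwards [ae_quarterDiskMeasure_pos (n + 1)] with p hp
        rw [mul_mul_mul_comm]
        exact mul_le_mul' (hu p hp.1 hp.2) (hv p hp.1 hp.2)
    _ ≤ X * Y * 1 := by
        rw [lintegral_const_mul _ (by fun_prop)]
        exact mul_le_mul' le_rfl (lintegral_quarterDiskMeasure_rpow_le n)
    _ = _ := mul_one _

/-- The first factor of the slices of the symbol `σ̂(ξ, η)`. -/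
def sliceFst (n : ℕ) (z : (ℝ × ℝ) × E d) : ℂ :=
  cosOscillatory (fun θ => (Real.sin θ : ℂ) ^ n)
    (2 * Real.pi * ‖z.2‖ * (z.1.1 / √(z.1.1 ^ 2 + z.1.2 ^ 2)))

/-- The second factor of the slices of the symbol `σ̂(ξ, η)`. -/
def sliceSnd (n : ℕ) (z : (ℝ × ℝ) × E d) : ℂ :=
  cosOscillatory (fun θ => (Real.sin θ : ℂ) ^ n)
    (2 * Real.pi * ‖z.2‖ * (z.1.2 / √(z.1.1 ^ 2 + z.1.2 ^ 2)))

theorem measurable_sliceFst (n : ℕ) : Measurable (sliceFst (d := d) n) :=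
  (continuous_cosOscillatory (W := fun θ => (Real.sin θ : ℂ) ^ n)
    (by fun_prop)).measurable.comp (by fun_prop)

theorem measurable_sliceSnd (n : ℕ) : Measurable (sliceSnd (d := d) n) :=
  (continuous_cosOscillatory (W := fun θ => (Real.sin θ : ℂ) ^ n)
    (by fun_prop)).measurable.comp (by fun_prop)

theorem norm_sliceFst_le (n : ℕ) (z : (ℝ × ℝ) × E d) : ‖sliceFst n z‖ ≤ Real.pi :=
  norm_cosOscillatory_sin_pow_le n _

theorem norm_sliceSnd_le (n : ℕ) (z : (ℝ × ℝ) × E d) : ‖sliceSnd n z‖ ≤ Real.pi :=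
  norm_cosOscillatory_sin_pow_le n _

/-- The integrand of the piece with `σ̂` replaced by the integral of its slices. -/
abbrev sliceIntegrand (n : ℕ) (φ : 𝓢(E d, ℂ)) (i j : ℕ)
    (f g : Lp ℂ 2 (volume : Measure (E d))) (x : E d) (q : E d × E d) : ℂ :=
  tensorIntegrand (quarterDiskMeasure (n + 1)) (sliceFst n) (sliceSnd n)
    (localizedHat φ i f) (localizedHat φ j g) x q

theorem IsLowFrequencyBump.integrable_sliceIntegrand (hφ : IsLowFrequencyBump φ) (n i j : ℕ)
    (f g : Lp ℂ 2 (volume : Measure (E d))) (x : E d) :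
    Integrable (sliceIntegrand n φ i j f g x) :=
  integrable_tensorIntegrand (measurable_sliceFst n) (measurable_sliceSnd n) (norm_sliceFst_le n)
    (norm_sliceSnd_le n) (hφ.integrable_localizedHat i f) (hφ.integrable_localizedHat j g)
    (measurable_localizedHat i f) (measurable_localizedHat j g) x

theorem IsLowFrequencyBump.stronglyMeasurable_integral_sliceIntegrand
    (hφ : IsLowFrequencyBump φ) (n i j : ℕ) (f g : Lp ℂ 2 (volume : Measure (E d))) :
    StronglyMeasurable fun x => ∫ q, sliceIntegrand n φ i j f g x q :=
  stronglyMeasurable_integral_tensorIntegrand (measurable_sliceFst n) (measurable_sliceSnd n)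
    (norm_sliceFst_le n) (norm_sliceSnd_le n) (hφ.integrable_localizedHat i f)
    (hφ.integrable_localizedHat j g) (measurable_localizedHat i f) (measurable_localizedHat j g)

theorem IsLowFrequencyBump.lintegral_eLpNorm_slices_le (hφ : IsLowFrequencyBump φ) {n : ℕ}
    {K C : ℝ} (hK0 : 0 ≤ K) (hK : ∀ ξ, ‖psiHat φ ξ‖ ≤ K) (hC0 : 0 ≤ C)
    (hC : ∀ l, 0 < l → ‖cosOscillatory (fun θ => (Real.sin θ : ℂ) ^ n) l‖ ≤
      C * l ^ (-(((n : ℝ) + 1) / 2)))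
    (i j : ℕ) (f g : Lp ℂ 2 (volume : Measure (E d))) :
    ∫⁻ p, eLpNorm (fun ξ => localizedHat φ i f ξ * sliceFst n (p, ξ)) 2 volume *
        eLpNorm (fun ξ => localizedHat φ j g ξ * sliceSnd n (p, ξ)) 2 volume
        ∂quarterDiskMeasure (n + 1) ≤
      ENNReal.ofReal (K * C * (2 : ℝ) ^ (-((i : ℝ) * (((n : ℝ) + 1) / 2))) * ‖f‖) *
        ENNReal.ofReal (K * C * (2 : ℝ) ^ (-((j : ℝ) * (((n : ℝ) + 1) / 2))) * ‖g‖) := by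
  have hf (t : ℝ) (ht : 0 < t) := hφ.eLpNorm_localizedHat_mul_le hK0 hK hC0 hC i f ht
  have hg (t : ℝ) (ht : 0 < t) := hφ.eLpNorm_localizedHat_mul_le hK0 hK hC0 hC j g ht
  generalize ENNReal.ofReal (K * C * (2 : ℝ) ^ (-((i : ℝ) * (((n : ℝ) + 1) / 2))) * ‖f‖) = X
    at hf ⊢
  generalize ENNReal.ofReal (K * C * (2 : ℝ) ^ (-((j : ℝ) * (((n : ℝ) + 1) / 2))) * ‖g‖) = Y
    at hg ⊢
  have hN (p : ℝ × ℝ) (h1 : 0 < p.1) (h2 : 0 < p.2) : 0 < √(p.1 ^ 2 + p.2 ^ 2) :=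
    Real.sqrt_pos.2 (add_pos (pow_pos h1 2) (pow_pos h2 2))
  have hf' (p : ℝ × ℝ) (h1 : 0 < p.1) (h2 : 0 < p.2) :
      eLpNorm (fun ξ => localizedHat φ i f ξ * sliceFst n (p, ξ)) 2 volume ≤
        X * ENNReal.ofReal ((p.1 / √(p.1 ^ 2 + p.2 ^ 2)) ^ (-(((n : ℝ) + 1) / 2))) :=
    hf (p.1 / √(p.1 ^ 2 + p.2 ^ 2)) (div_pos h1 (hN p h1 h2))
  have hg' (p : ℝ × ℝ) (h1 : 0 < p.1) (h2 : 0 < p.2) :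
      eLpNorm (fun ξ => localizedHat φ j g ξ * sliceSnd n (p, ξ)) 2 volume ≤
        Y * ENNReal.ofReal ((p.2 / √(p.1 ^ 2 + p.2 ^ 2)) ^ (-(((n : ℝ) + 1) / 2))) :=
    hg (p.2 / √(p.1 ^ 2 + p.2 ^ 2)) (div_pos h2 (hN p h1 h2))
  exact lintegral_mul_quarterDiskMeasure_le hf' hg'

theorem IsLowFrequencyBump.exists_eLpNorm_integral_sliceIntegrand_le (hφ : IsLowFrequencyBump φ)
    (n : ℕ) : ∃ M : ℝ, 0 ≤ M ∧ ∀ (i j : ℕ) (f g : Lp ℂ 2 (volume : Measure (E d))),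
      eLpNorm (fun x => ∫ q, sliceIntegrand n φ i j f g x q) 1 volume ≤
        ENNReal.ofReal (M * (2 : ℝ) ^ (-(((i : ℝ) + (j : ℝ)) * (((n : ℝ) + 1) / 2))) *
          ‖f‖ * ‖g‖) := by
  obtain ⟨C, hC0, hC⟩ := exists_norm_cosOscillatory_le_rpow n
  obtain ⟨K, hK0, hK⟩ := exists_norm_psiHat_le φ
  refine ⟨(K * C) ^ 2, sq_nonneg _, fun i j f g => ?_⟩
  have h := eLpNorm_integral_tensorIntegrand_le (Q := quarterDiskMeasure (n + 1))
    (measurable_sliceFst n) (measurable_sliceSnd n)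
    (norm_sliceFst_le n) (norm_sliceSnd_le n) (hφ.integrable_localizedHat i f)
    (hφ.integrable_localizedHat j g) (measurable_localizedHat i f) (measurable_localizedHat j g)
    (memLp_localizedHat i f) (memLp_localizedHat j g)
  refine (h.trans (hφ.lintegral_eLpNorm_slices_le hK0 hK hC0 hC i j f g)).trans_eq ?_
  rw [← ENNReal.ofReal_mul (by positivity), add_mul, neg_add, Real.rpow_add two_pos]
  refine congrArg ENNReal.ofReal ?_
  ring

theorem pieceIntegrand_eq_smul {n : ℕ} {c : ℝ} (φ : 𝓢(E d, ℂ))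
    (hc : ∀ ξ η : E d, sphereMeasureHat d ξ η =
      c * ∫ p, sliceFst n (p, ξ) * sliceSnd n (p, η) ∂quarterDiskMeasure (n + 1)) (i j : ℕ)
    (f g : Lp ℂ 2 (volume : Measure (E d))) (x : E d) :
    pieceIntegrand φ i j f g x = fun q => (c : ℂ) * sliceIntegrand n φ i j f g x q := by
  ext q
  rw [pieceIntegrand, hc, sliceIntegrand, tensorIntegrand, localizedHat, localizedHat]
  ring

theorem sphericalPiece_eq_smul {n : ℕ} {c : ℝ} (φ : 𝓢(E d, ℂ))
    (hc : ∀ ξ η : E d, sphereMeasureHat d ξ η =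
      c * ∫ p, sliceFst n (p, ξ) * sliceSnd n (p, η) ∂quarterDiskMeasure (n + 1)) (i j : ℕ)
    (f g : Lp ℂ 2 (volume : Measure (E d))) :
    sphericalPiece φ i j f g = (c : ℂ) • fun x => ∫ q, sliceIntegrand n φ i j f g x q := by
  ext x
  rw [sphericalPiece, pieceIntegrand_eq_smul φ hc, integral_const_mul]
  rfl

end BilinearSpherical

end

/-! ### The estimate. -/

open BilinearSpherical

theorem mainTheorem5 (d : ℕ) (hd : 2 ≤ d) (φ : SchwartzMap (BilinearSpherical.E d) ℂ)
    (hφ : BilinearSpherical.IsLowFrequencyBump φ) :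
    ∃ C : ℝ, 0 < C ∧ ∀ i j : ℕ, 1 ≤ i → 1 ≤ j →
      ∀ f g : MeasureTheory.Lp ℂ 2 (MeasureTheory.volume : MeasureTheory.Measure
        (BilinearSpherical.E d)),
        (∀ x, MeasureTheory.Integrable (BilinearSpherical.pieceIntegrand φ i j f g x)
          MeasureTheory.volume) ∧
        MeasureTheory.MemLp (BilinearSpherical.sphericalPiece φ i j f g) 1
          MeasureTheory.volume ∧
        MeasureTheory.eLpNorm (BilinearSpherical.sphericalPiece φ i j f g) 1
            MeasureTheory.volume ≤
          ENNReal.ofReal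
            (C * (2 : ℝ) ^ (-(((i : ℝ) + (j : ℝ)) * (((d : ℝ) - 1) / 2))) * ‖f‖ * ‖g‖) := by
  -- Here `n = d - 2` is the power of `sin θ` in the polar density of `S^{d-1}`, so the decay
  -- exponent `(n + 1) / 2` is `(d - 1) / 2`.
  obtain ⟨n, rfl⟩ := Nat.exists_eq_add_of_le' hd
  obtain ⟨c, hc⟩ := exists_sphereMeasureHat_eq n
  obtain ⟨M, hM0, hM⟩ := hφ.exists_eLpNorm_integral_sliceIntegrand_le n
  have hn : ((n + 2 : ℕ) : ℝ) - 1 = n + 1 := by push_cast; ring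
  rw [hn]
  -- The added `1` ensures a positive constant, since `c` and `M` are not shown to be nonzero.
  refine ⟨|c| * M + 1, by positivity, fun i j _ _ f g => ?_⟩
  have hT := sphericalPiece_eq_smul φ hc i j f g
  have hbound : eLpNorm (sphericalPiece φ i j f g) 1 volume ≤ ENNReal.ofReal
      ((|c| * M + 1) * (2 : ℝ) ^ (-(((i : ℝ) + (j : ℝ)) * (((n : ℝ) + 1) / 2))) *
        ‖f‖ * ‖g‖) := by
    rw [hT, eLpNorm_const_smul, ← ofReal_norm, Complex.norm_real, Real.norm_eq_abs]
    refine (mul_le_mul' le_rfl (hM i j f g)).trans ?_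
    rw [← ENNReal.ofReal_mul (abs_nonneg c)]
    refine ENNReal.ofReal_le_ofReal ?_
    rw [← mul_assoc, ← mul_assoc, ← mul_assoc]
    gcongr
    linarith
  refine ⟨fun x => ?_, ⟨?_, hbound.trans_lt ENNReal.ofReal_lt_top⟩, hbound⟩
  · rw [pieceIntegrand_eq_smul φ hc]
    exact (hφ.integrable_sliceIntegrand n i j f g x).const_mul _
  · rw [hT]
    exact (hφ.stronglyMeasurable_integral_sliceIntegrand n i j f
      g).aestronglyMeasurable.const_smul _
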